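/- Let $\mathrm{sn}$ be the Jacobi elliptic function of modulus $k\in\mathbb C\setminus\{0,\pm1\}$, with $k=\theta_2(0)^2/\theta_3(0)^2$ for a parameter $\tau$ in the upper half plane, and fix a square root $\sqrt k$. Put $$\mathcal Q_{\alpha,\beta}(u,\tilde u,\hat u,\hat{\tilde u})=\mathrm{sn}(\alpha)(u\tilde u+\hat u\hat{\tilde u})-\mathrm{sn}(\beta)(u\hat u+\tilde u\hat{\tilde u})-\mathrm{sn}(\alpha-\beta)\bigl(u\hat{\tilde u}+\tilde u\hat u-k\,\mathrm{sn}(\alpha)\,\mathrm{sn}(\beta)(1+u\tilde u\hat u\hat{\tilde u})\bigr).$$ Let $\alpha,\beta,\kappa,\zeta_0\in\mathbb C$ be such that none of $\alpha,\beta,\kappa,\alpha-\beta,\alpha-\kappa,\beta-\kappa$ is a pole of $\mathrm{sn}$. For $f$ on $\mathbb Z^2$ write $\tilde f$, $\hat f$ for its shifts in $n$ and $m$. All equations between elements of $\mathbb C\cup\{\infty\}$ are read in homogeneous coordinates. Put $\mathcal B_1=\mathcal Q_{\alpha,\kappa}$, $\mathcal B_2=\mathcal Q_{\beta,\kappa}$,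 and for $i=1,2$ $$\mathcal H_i=(\partial_3\mathcal B_i)(\partial_4\mathcal B_i)-(\partial_3\partial_4\mathcal B_i)\mathcal B_i,\qquad \mathcal H_i^*=(\partial_1\mathcal B_i)(\partial_2\mathcal B_i)-(\partial_1\partial_2\mathcal B_i)\mathcal B_i .$$ Let $w=\sqrt k\,\mathrm{sn}(\zeta)$ with $\zeta=\zeta_0+n\alpha+m\beta$, a function $\mathbb Z^2\to\mathbb C\cup\{\infty\}$. Then $\mathcal H_1^*(w,\tilde w)=0$ and $\mathcal H_2^*(w,\hat w)=0$ on $\mathbb Z^2$. Let $u:\mathbb Z^2\to\mathbb C\cup\{\infty\}$ be a solution of $\mathcal Q_{\alpha,\beta}(u,\tilde u,\hat u,\hat{\tilde u})=0$ that is non-singular, i.e. $\mathcal H_1(u,\tilde u)\ne0$ and $\mathcal H_2(u,\hat u)\neq0$ on $\mathbb Z^2$. Let $\mathfrak m_1,\mathfrak m_2$ be the Möbius transformations $v\mapsto\tilde v$ and $v\mapsto\hat v$ defined by $\mathcal B_1(u,\tilde u,v,\tilde v)=0$ and $\mathcal B_2(u,\hat u,v,\hat v)=0$. Let $\varphi$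 be a Schwarzian variable of $u$, i.e. $\varphi=\mathfrak s^{-1}(w)$ for a function $\mathfrak s$ from $\mathbb Z^2$ to the Möbius group with $\tilde{\mathfrak s}=\mathfrak m_1\mathfrak s$ and $\hat{\mathfrak s}=\mathfrak m_2\mathfrak s$. Set $$p=\sqrt k\,\mathrm{sn}(\alpha),\quad p_-=\sqrt k\,\mathrm{sn}(\alpha-\kappa),\quad q=\sqrt k\,\mathrm{sn}(\beta),\quad q_-=\sqrt k\,\mathrm{sn}(\beta-\kappa),\quad s=\sqrt k\,\mathrm{sn}(\kappa),\quad w_\pm=\sqrt k\,\mathrm{sn}(\zeta\pm\kappa).$$ Then, at every $(n,m)$ at which no three of $\varphi,\tilde\varphi,\hat\varphi,\hat{\tilde\varphi}$ coincide (so that the cross-ratio is defined) and $w_+,\tilde w_+,\hat w_+,\tilde w_-,\hat w_-,\hat{\tilde w}_-$ are finite (if one of these is infinite, the right-hand side below contains $\infty$ as a term or has the form $0/0$), the numerator and the denominator on the right-hand side are not both zero and $$\frac{(\varphi-\tilde\varphi)(\hat\varphi-\hat{\tilde\varphi})}{(\varphi-\hat\varphi)(\tilde\varphi-\hat{\tilde\varphi})}=\frac{p\,q_-\,(1+w\tilde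 w s p_-)(1+\hat w\hat{\tilde w}sp_-)(\tilde u-\tilde w_-)(\hat u-\hat w_+)}{q\,p_-\,(1+w\hat w s q_-)(1+\tilde w\hat{\tilde w}sq_-)(\tilde u-\tilde w_+)(\hat u-\hat w_-)}$$ as an equality in $\mathbb C\cup\{\infty\}$. -/

import Mathlib

open scoped OnePoint MatrixGroups

noncomputable section

namespace Q4

/-! ### The Jacobi elliptic function `sn` -/

/-- The theta functions `θ₁, θ₂, θ₃, θ₄` with quasi-period `τ` (nome `exp (π i τ)`), in the
variable `v` normalised so that the classical argument is `π v`. -/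
def theta1 (τ v : ℂ) : ℂ :=
  -Complex.I * Complex.exp (Real.pi * Complex.I * τ / 4 + Real.pi * Complex.I * v) *
    jacobiTheta₂ (v + τ / 2 + 1 / 2) τ

/-- See `theta1`. -/
def theta2 (τ v : ℂ) : ℂ :=
  Complex.exp (Real.pi * Complex.I * τ / 4 + Real.pi * Complex.I * v) *
    jacobiTheta₂ (v + τ / 2) τ

/-- See `theta1`. -/
def theta3 (τ v : ℂ) : ℂ := jacobiTheta₂ v τ

/-- See `theta1`. -/
def theta4 (τ v : ℂ) : ℂ := jacobiTheta₂ (v + 1 / 2) τ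

/-- The modulus `k = θ₂(0)² / θ₃(0)²`. As `τ` runs over the upper half plane, `k` runs over all
complex numbers other than `0, 1, -1`. -/
def modulus (τ : ℂ) : ℂ := theta2 τ 0 ^ 2 / theta3 τ 0 ^ 2

/-- The argument of the theta functions belonging to `z`, i.e. `z / (π θ₃(0)²) = z / (2 K)`. -/
def thetaArg (τ z : ℂ) : ℂ := z / (Real.pi * theta3 τ 0 ^ 2)

/-- `z` is a pole of `sn` with modulus `modulus τ`. -/
def IsSnPole (τ z : ℂ) : Prop := theta4 τ (thetaArg τ z) = 0

/-- The Jacobi function `sn z` of modulus `modulus τ`, at the points `z` that are not poles. -/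
def sn (τ z : ℂ) : ℂ :=
  theta3 τ 0 / theta2 τ 0 * (theta1 τ (thetaArg τ z) / theta4 τ (thetaArg τ z))

open Classical in
/-- The function `r * sn z` with values in `ℂ ∪ {∞}`, for a constant `r ≠ 0`. -/
def scaledSn (τ r z : ℂ) : OnePoint ℂ := if IsSnPole τ z then ∞ else ((r * sn τ z : ℂ) : OnePoint ℂ)

/-! ### The projective line `ℂ ∪ {∞}` -/

/-- Homogeneous coordinates of a point of `ℂ ∪ {∞}`: `x ↦ (x : 1)` and `∞ ↦ (1 : 0)`. -/
def coords : OnePoint ℂ → ℂ × ℂ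
  | ∞ => (1, 0)
  | (x : ℂ) => (x, 1)

/-- The point `(N : D)` of `ℂ ∪ {∞}`, meaningful if `N` and `D` are not both zero. -/
def ratio (N D : ℂ) : OnePoint ℂ := if D = 0 then ∞ else ((N / D : ℂ) : OnePoint ℂ)

/-- The homogeneous form of the difference `x - y`. -/
def hsub (X Y : ℂ × ℂ) : ℂ := X.1 * Y.2 - Y.1 * X.2

/-- The cross-ratio `(a - b) (c - d) / ((a - c) (b - d))` of points of `ℂ ∪ {∞}`. -/
def crossRatio (a b c d : OnePoint ℂ) : OnePoint ℂ :=
  ratio (hsub (coords a) (coords b) * hsub (coords c) (coords d))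
    (hsub (coords a) (coords c) * hsub (coords b) (coords d))

/-- No three of the four points coincide; this is exactly the condition under which numerator and
denominator of the cross-ratio do not both vanish. -/
def NoThreeCoincide (a b c d : OnePoint ℂ) : Prop :=
  ¬ (a = b ∧ b = c) ∧ ¬ (a = b ∧ b = d) ∧ ¬ (a = c ∧ c = d) ∧ ¬ (b = c ∧ c = d)

/-- The group `M` of Möbius transformations of `ℂ ∪ {∞}`. -/
abbrev Moebius : Subgroup (Equiv.Perm (OnePoint ℂ)) :=
  (MulAction.toPermHom (GL (Fin 2) ℂ) (OnePoint ℂ)).range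

/-! ### Polynomials of degree one in each of four variables, in homogeneous coordinates

A polynomial `F(x₁, x₂, x₃, x₄)` of degree at most one in each variable is handled through its
multihomogeneous form, in which `xᵢ` is replaced by a pair `(Xᵢ, Yᵢ)`, so that its vanishing makes
sense for arguments in `ℂ ∪ {∞}`. -/

/-- Functions of four pairs of homogeneous coordinates. -/
abbrev Form := ℂ × ℂ → ℂ × ℂ → ℂ × ℂ → ℂ × ℂ → ℂ

/-- The equation `F(a, b, c, d) = 0` for `a, b, c, d` in `ℂ ∪ {∞}`. -/
def Form.Vanishes (F : Form) (a b c d : OnePoint ℂ) : Prop :=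
  F (coords a) (coords b) (coords c) (coords d) = 0

/-- Homogeneous form of `(∂₃F) (∂₄F) - (∂₃∂₄F) F`, a biquadratic in the first two variables:
if `F = c₀ + c₁ x₃ + c₂ x₄ + c₃ x₃ x₄`, this is `c₁ c₂ - c₃ c₀`. -/
def Form.disc34 (F : Form) (X Y : ℂ × ℂ) : ℂ :=
  F X Y (1, 0) (0, 1) * F X Y (0, 1) (1, 0) - F X Y (1, 0) (1, 0) * F X Y (0, 1) (0, 1)

/-- Homogeneous form of `(∂₁F) (∂₂F) - (∂₁∂₂F) F`, a biquadratic in the last two variables. -/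
def Form.disc12 (F : Form) (X Y : ℂ × ℂ) : ℂ :=
  F (1, 0) (0, 1) X Y * F (0, 1) (1, 0) X Y - F (1, 0) (1, 0) X Y * F (0, 1) (0, 1) X Y

/-- The polynomial `Q_{α,β}(u, ũ, û, ũ̂)`. -/
def qPoly (τ α β u ut uh uth : ℂ) : ℂ :=
  sn τ α * (u * ut + uh * uth) - sn τ β * (u * uh + ut * uth) -
    sn τ (α - β) *
      (u * uth + ut * uh - modulus τ * sn τ α * sn τ β * (1 + u * ut * uh * uth))

/-- The multihomogeneous form of `Q_{α,β}`. -/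
def qForm (τ α β : ℂ) : Form := fun U Ut Uh Uth =>
  sn τ α * (U.1 * Ut.1 * Uh.2 * Uth.2 + U.2 * Ut.2 * Uh.1 * Uth.1) -
    sn τ β * (U.1 * Ut.2 * Uh.1 * Uth.2 + U.2 * Ut.1 * Uh.2 * Uth.1) -
    sn τ (α - β) *
      (U.1 * Ut.2 * Uh.2 * Uth.1 + U.2 * Ut.1 * Uh.1 * Uth.2 -
        modulus τ * sn τ α * sn τ β *
          (U.2 * Ut.2 * Uh.2 * Uth.2 + U.1 * Ut.1 * Uh.1 * Uth.1))

/-- `qForm` is `qPoly` at finite points. -/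
theorem qForm_coe (τ α β u ut uh uth : ℂ) :
    qForm τ α β (coords (u : OnePoint ℂ)) (coords (ut : OnePoint ℂ)) (coords (uh : OnePoint ℂ))
      (coords (uth : OnePoint ℂ)) = qPoly τ α β u ut uh uth := by
  simp [qForm, qPoly, coords]

theorem disc_aux (c₀ c₁ c₂ c₃ x y : ℂ) :
    deriv (fun x' => c₀ + c₁ * x' + c₂ * y + c₃ * x' * y) x *
        deriv (fun y' => c₀ + c₁ * x + c₂ * y' + c₃ * x * y') y -
      deriv (fun x' => deriv (fun y' => c₀ + c₁ * x' + c₂ * y' + c₃ * x' * y') y) x *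
        (c₀ + c₁ * x + c₂ * y + c₃ * x * y) = c₁ * c₂ - c₃ * c₀ := by
  have h1 : ∀ y x : ℂ, deriv (fun x' => c₀ + c₁ * x' + c₂ * y + c₃ * x' * y) x = c₁ + c₃ * y := by
    intro y x
    have h : HasDerivAt (fun x' : ℂ => (c₀ + c₂ * y) + (c₁ + c₃ * y) * x')
        ((c₁ + c₃ * y) * 1) x := ((hasDerivAt_id x).const_mul _).const_add _
    rw [mul_one] at h
    rw [← h.deriv]
    congr 1
    ext x'
    ring
  have h2 : ∀ x y : ℂ, deriv (fun y' => c₀ + c₁ * x + c₂ * y' + c₃ * x * y') y = c₂ + c₃ * x := by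
    intro x y
    have h : HasDerivAt (fun y' : ℂ => (c₀ + c₁ * x) + (c₂ + c₃ * x) * y')
        ((c₂ + c₃ * x) * 1) y := ((hasDerivAt_id y).const_mul _).const_add _
    rw [mul_one] at h
    rw [← h.deriv]
    congr 1
    ext y'
    ring
  have h3 : deriv (fun x' => c₂ + c₃ * x') x = c₃ := by
    have h : HasDerivAt (fun x' : ℂ => c₂ + c₃ * x') (c₃ * 1) x :=
      ((hasDerivAt_id x).const_mul _).const_add _
    rw [mul_one] at h
    exact h.deriv
  simp only [h1, h2, h3]
  ring

/-- `disc34` of `Q_{α,β}` is `(∂₃Q) (∂₄Q) - (∂₃∂₄Q) Q` at finite points. -/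
theorem disc34_qForm_coe (τ α β u ut v vt : ℂ) :
    (qForm τ α β).disc34 (coords (u : OnePoint ℂ)) (coords (ut : OnePoint ℂ)) =
      deriv (fun x => qPoly τ α β u ut x vt) v * deriv (fun y => qPoly τ α β u ut v y) vt -
        deriv (fun x => deriv (fun y => qPoly τ α β u ut x y) vt) v * qPoly τ α β u ut v vt := by
  have h := disc_aux (qForm τ α β (u, 1) (ut, 1) (0, 1) (0, 1))
    (qForm τ α β (u, 1) (ut, 1) (1, 0) (0, 1)) (qForm τ α β (u, 1) (ut, 1) (0, 1) (1, 0))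
    (qForm τ α β (u, 1) (ut, 1) (1, 0) (1, 0)) v vt
  have e : ∀ x y : ℂ, qPoly τ α β u ut x y = qForm τ α β (u, 1) (ut, 1) (0, 1) (0, 1) +
      qForm τ α β (u, 1) (ut, 1) (1, 0) (0, 1) * x +
      qForm τ α β (u, 1) (ut, 1) (0, 1) (1, 0) * y +
      qForm τ α β (u, 1) (ut, 1) (1, 0) (1, 0) * x * y := by
    intro x y
    simp only [qForm, qPoly]
    ring
  simp only [e]
  rw [h]
  rfl

/-- `disc12` of `Q_{α,β}` is `(∂₁Q) (∂₂Q) - (∂₁∂₂Q) Q` at finite points. -/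
theorem disc12_qForm_coe (τ α β u ut v vt : ℂ) :
    (qForm τ α β).disc12 (coords (v : OnePoint ℂ)) (coords (vt : OnePoint ℂ)) =
      deriv (fun x => qPoly τ α β x ut v vt) u * deriv (fun y => qPoly τ α β u y v vt) ut -
        deriv (fun x => deriv (fun y => qPoly τ α β x y v vt) ut) u * qPoly τ α β u ut v vt := by
  have h := disc_aux (qForm τ α β (0, 1) (0, 1) (v, 1) (vt, 1))
    (qForm τ α β (1, 0) (0, 1) (v, 1) (vt, 1)) (qForm τ α β (0, 1) (1, 0) (v, 1) (vt, 1))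
    (qForm τ α β (1, 0) (1, 0) (v, 1) (vt, 1)) u ut
  have e : ∀ x y : ℂ, qPoly τ α β x y v vt = qForm τ α β (0, 1) (0, 1) (v, 1) (vt, 1) +
      qForm τ α β (1, 0) (0, 1) (v, 1) (vt, 1) * x +
      qForm τ α β (0, 1) (1, 0) (v, 1) (vt, 1) * y +
      qForm τ α β (1, 0) (1, 0) (v, 1) (vt, 1) * x * y := by
    intro x y
    simp only [qForm, qPoly]
    ring
  simp only [e]
  rw [h]
  rfl

/-! ### Bäcklund systems and Schwarzian variables

Functions on the lattice `ℤ²` are functions of `n m : ℤ`; the shift `~` increases `n` and the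
shift `^` increases `m`. -/

/-- `u` solves the quadrilateral equation `P(u, ũ, û, ũ̂) = 0`. -/
def IsSolution (P : Form) (u : ℤ → ℤ → OnePoint ℂ) : Prop :=
  ∀ n m, P.Vanishes (u n m) (u (n + 1) m) (u n (m + 1)) (u (n + 1) (m + 1))

/-- `u` is non-singular for the Bäcklund system given by `B₁` and `B₂`. -/
def IsNonsingular (B₁ B₂ : Form) (u : ℤ → ℤ → OnePoint ℂ) : Prop :=
  ∀ n m, B₁.disc34 (coords (u n m)) (coords (u (n + 1) m)) ≠ 0 ∧
    B₂.disc34 (coords (u n m)) (coords (u n (m + 1))) ≠ 0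

/-- `w` solves the two biquadratic equations dual to the ones that define singularity. -/
def IsDualSingular (B₁ B₂ : Form) (w : ℤ → ℤ → OnePoint ℂ) : Prop :=
  ∀ n m, B₁.disc12 (coords (w n m)) (coords (w (n + 1) m)) = 0 ∧
    B₂.disc12 (coords (w n m)) (coords (w n (m + 1))) = 0

/-- The Möbius transformation `f` is the map `v ↦ v'` defined by `B(a, b, v, v') = 0`. -/
def IsRiccatiMap (B : Form) (a b : OnePoint ℂ) (f : Moebius) : Prop :=
  ∀ v : OnePoint ℂ, B.Vanishes a b v (f.1 v)

/-- `s : ℤ² → M` solves the Bäcklund system `s~ = m₁ s`, `s^ = m₂ s`, where `m₁ : v ↦ v~` and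
`m₂ : v ↦ v^` are the Möbius transformations defined by `B₁(u, ũ, v, v~) = 0` and
`B₂(u, û, v, v^) = 0`. -/
def SolvesBacklund (B₁ B₂ : Form) (u : ℤ → ℤ → OnePoint ℂ) (s : ℤ → ℤ → Moebius) : Prop :=
  ∃ m₁ m₂ : ℤ → ℤ → Moebius,
    ∀ n m, IsRiccatiMap B₁ (u n m) (u (n + 1) m) (m₁ n m) ∧
      IsRiccatiMap B₂ (u n m) (u n (m + 1)) (m₂ n m) ∧
      s (n + 1) m = m₁ n m * s n m ∧ s n (m + 1) = m₂ n m * s n m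

/-- `φ` is a Schwarzian variable associated to `u`, with fixed function `w`: `φ = s⁻¹(w)` for some
solution `s` of the Bäcklund system. -/
def IsSchwarzianVariable (B₁ B₂ : Form) (w u φ : ℤ → ℤ → OnePoint ℂ) : Prop :=
  ∃ s : ℤ → ℤ → Moebius, SolvesBacklund B₁ B₂ u s ∧ ∀ n m, φ n m = ((s n m)⁻¹).1 (w n m)

/-! ### The right-hand side -/

/-- `ζ = ζ₀ + n α + m β`. -/
def zeta (ζ₀ α β : ℂ) (n m : ℤ) : ℂ := ζ₀ + n * α + m * β

/-- Homogeneous form of `1 + x y c`. -/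
def honeAdd (X Y : ℂ × ℂ) (c : ℂ) : ℂ := X.2 * Y.2 + X.1 * Y.1 * c

/-- Homogeneous form of `x - c` for a finite number `c`. -/
def hsubC (X : ℂ × ℂ) (c : ℂ) : ℂ := X.1 - c * X.2

/-- Numerator of the right-hand side, in homogeneous coordinates of `w, w~, w^, w^~, u~, u^`:
`p q₋ (1 + w w~ s p₋) (1 + w^ w^~ s p₋) (u~ - w₋~) (u^ - w₊^)`, where `p = r sn α`,
`p₋ = r sn (α - κ)`, `q₋ = r sn (β - κ)`, `s = r sn κ`, `w = r sn ζ`, `w₋ = r sn (ζ - κ)`,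
`w₊ = r sn (ζ + κ)`, and `~`, `^` add `α`, `β` to `ζ`. -/
def rhsNum (τ r α β κ ζ : ℂ) (ut uh : OnePoint ℂ) : ℂ :=
  (r * sn τ α) * (r * sn τ (β - κ)) *
    honeAdd (coords (scaledSn τ r ζ)) (coords (scaledSn τ r (ζ + α)))
      ((r * sn τ κ) * (r * sn τ (α - κ))) *
    honeAdd (coords (scaledSn τ r (ζ + β))) (coords (scaledSn τ r (ζ + α + β)))
      ((r * sn τ κ) * (r * sn τ (α - κ))) *
    hsubC (coords ut) (r * sn τ (ζ + α - κ)) * hsubC (coords uh) (r * sn τ (ζ + β + κ))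

/-- Denominator of the right-hand side, in the same homogeneous coordinates:
`q p₋ (1 + w w^ s q₋) (1 + w~ w^~ s q₋) (u~ - w₊~) (u^ - w₋^)`, where `q = r sn β`. -/
def rhsDen (τ r α β κ ζ : ℂ) (ut uh : OnePoint ℂ) : ℂ :=
  (r * sn τ β) * (r * sn τ (α - κ)) *
    honeAdd (coords (scaledSn τ r ζ)) (coords (scaledSn τ r (ζ + β)))
      ((r * sn τ κ) * (r * sn τ (β - κ))) *
    honeAdd (coords (scaledSn τ r (ζ + α))) (coords (scaledSn τ r (ζ + α + β)))
      ((r * sn τ κ) * (r * sn τ (β - κ))) *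
    hsubC (coords ut) (r * sn τ (ζ + α + κ)) * hsubC (coords uh) (r * sn τ (ζ + β - κ))

end Q4

end

/-!
Everything rests on writing `√k sn` as a quotient of entire functions and on working with
homogeneous coordinates, so that poles need no special treatment.

**Theta functions.** The products `θᵢ(x + y) θᵢ(x - y)` are bilinear in two theta functions of the
doubled quasi-period (`theta3_mul` and its shifts). Polynomial algebra turns this into the four-term
formulas `theta_add₁` and `theta_add₂`. The constants `θ₂(0)`, `θ₃(0)`, `θ₄(0)` are nonzero since
otherwise the squares of two theta functions with opposite multipliers would be proportional
(`eq_zero_of_sq_eq`). The four-term formulas yield the factorisation `quadForm_snVec`,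
which says that `B₁(u, ũ, w, w̃)` is `(1 + w w̃ s p₋) (u - w₊) (ũ - w̃₋)` up to a constant and hence
implies the equations for `w`, and two algebraic relations between the parameters (`sn_relation₁`,
`sn_relation₂`).

**The square.** Modulo these two relations the Riccati maps along the two ways around a square
agree, as matrices, up to the scalar given in `lin_lin_comm`. That scalar is the ratio of the
determinants of the two second steps times `q q₋ / (p p₋)`.

**The cross-ratio.** Applying the Möbius transformation at the first vertex to the four values of
`φ` leaves the cross-ratio unchanged. Each
difference of two of the images is a value of `B₁` or `B₂` at `u` and `w`, divided by a determinant
(`cross_mul_eq`). The determinants combine to `q q₋ / (p p₋)`, the values of `B` factor, and the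
linear factors in the values of `u` at the first and at the last vertex cancel.
-/

namespace Q4

/-! ### The algebra of the multi-affine form -/

/-- The form of `Q4` with free parameters: `qForm τ α β` is `quadForm p q d` up to the factor
`√k`, where `p`, `q`, `d` are `√k sn` of `α`, `β`, `α - β`. -/
def quadForm (p q d : ℂ) : Form := fun U A B C =>
  p * (U.1 * A.1 * B.2 * C.2 + U.2 * A.2 * B.1 * C.1) -
    q * (U.1 * A.2 * B.1 * C.2 + U.2 * A.1 * B.2 * C.1) -
    d * (U.1 * A.2 * B.2 * C.1 + U.2 * A.1 * B.1 * C.2 -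
      p * q * (U.2 * A.2 * B.2 * C.2 + U.1 * A.1 * B.1 * C.1))

/-- The linear map in homogeneous coordinates that solves `F(X, Y, V, V') = 0` for `V'`. -/
def Form.lin (F : Form) (X Y V : ℂ × ℂ) : ℂ × ℂ := (-F X Y V (0, 1), F X Y V (1, 0))

theorem quadForm_eq_hsub (p q d : ℂ) (X Y V T : ℂ × ℂ) :
    quadForm p q d X Y V T = hsub T ((quadForm p q d).lin X Y V) := by
  simp only [quadForm, hsub, Form.lin]; ring

theorem quadForm_swap (p q d : ℂ) (U A B C : ℂ × ℂ) :
    quadForm p q d U A B C = quadForm p q d A U C B := by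
  simp only [quadForm]; ring

theorem hsub_lin_lin (p q d : ℂ) (X Y V T : ℂ × ℂ) :
    hsub ((quadForm p q d).lin X Y V) ((quadForm p q d).lin X Y T) =
      -(quadForm p q d).disc34 X Y * hsub V T := by
  simp only [quadForm, hsub, Form.lin, Form.disc34]; ring

theorem lin_smul (p q d c : ℂ) (X Y V : ℂ × ℂ) :
    (quadForm p q d).lin X Y (c • V) = c • (quadForm p q d).lin X Y V := by
  ext <;> simp only [quadForm, Form.lin, Prod.smul_fst, Prod.smul_snd, smul_eq_mul] <;> ring

theorem lin_smul_fst (p q d c : ℂ) (X Y V : ℂ × ℂ) :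
    (quadForm p q d).lin (c • X) Y V = c • (quadForm p q d).lin X Y V := by
  ext <;> simp only [quadForm, Form.lin, Prod.smul_fst, Prod.smul_snd, smul_eq_mul] <;> ring

theorem lin_smul_snd (p q d c : ℂ) (X Y V : ℂ × ℂ) :
    (quadForm p q d).lin X (c • Y) V = c • (quadForm p q d).lin X Y V := by
  ext <;> simp only [quadForm, Form.lin, Prod.smul_fst, Prod.smul_snd, smul_eq_mul] <;> ring

theorem disc34_smul_fst (p q d c : ℂ) (X Y : ℂ × ℂ) :
    (quadForm p q d).disc34 (c • X) Y = c ^ 2 * (quadForm p q d).disc34 X Y := by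
  simp only [quadForm, Form.disc34, Prod.smul_fst, Prod.smul_snd, smul_eq_mul]; ring

theorem exists_smul_of_hsub_eq_zero {X Y : ℂ × ℂ} (hY : Y ≠ 0) (h : hsub X Y = 0) :
    ∃ c : ℂ, X = c • Y := by
  obtain ⟨x, x'⟩ := X
  obtain ⟨y, y'⟩ := Y
  simp only [hsub] at h
  by_cases hy : y = 0
  · subst hy
    have hy' : y' ≠ 0 := fun h' => hY (by simp [h'])
    refine ⟨x' / y', ?_⟩
    have : x = 0 := by simpa [hy'] using h
    ext
    · simp [this]
    · simp [hy']
  · refine ⟨x / y, ?_⟩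
    ext
    · simp [hy]
    · simp only [Prod.smul_snd, smul_eq_mul]
      field_simp
      linear_combination -h

/-- The biquadratic discriminant of `F` in the second and third slot. -/
def Form.disc23 (F : Form) (X Y : ℂ × ℂ) : ℂ :=
  F X (1, 0) (0, 1) Y * F X (0, 1) (1, 0) Y - F X (1, 0) (1, 0) Y * F X (0, 1) (0, 1) Y

/-- The biquadratic discriminant of `F` in the first and third slot. -/
def Form.disc13 (F : Form) (X Y : ℂ × ℂ) : ℂ :=
  F (1, 0) X (0, 1) Y * F (0, 1) X (1, 0) Y - F (1, 0) X (1, 0) Y * F (0, 1) X (0, 1) Y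

section

/- Throughout, `p`, `q`, `d`, `s`, `p'`, `q'` stand for `√k sn` of `α`, `β`, `α - β`, `κ`, `α - κ`,
`β - κ`; the hypotheses `h₁` and `h₂` are the two relations between these numbers that hold by
`sn_relation₁` and `sn_relation₂`. -/
variable {p q d s p' q' : ℂ}

/-- With `Z` the solution of `Q(U, A, Z, C) = 0`, written as a polynomial in `U`, `A`, `C`, the two
ways around the square are proportional. As `Z` is not normalised, no division occurs. -/
theorem lin_lin_add_disc23_smul
    (h₁ : p * q' - q * p' + s * d - s * d * p * q * p' * q' = 0)
    (h₂ : p * q * d - p * s * p' + q * s * q' - d * p' * q' = 0) (U A C V : ℂ × ℂ) :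
    (quadForm p s p').lin ((quadForm p q d).lin A U C) C
        ((quadForm q s q').lin U ((quadForm p q d).lin A U C) V) +
      (quadForm p q d).disc23 U C •
        (quadForm q s q').lin A C ((quadForm p s p').lin U A V) = 0 := by
  obtain ⟨u₁, u₂⟩ := U
  obtain ⟨a₁, a₂⟩ := A
  obtain ⟨c₁, c₂⟩ := C
  obtain ⟨v₁, v₂⟩ := V
  -- `f` and `g` are the common factors of the cofactors of `h₁` and `h₂` in the four entries of the
  -- identity, regarded as an identity of `2 × 2` matrices; they are kept opaque for `ring`.
  obtain ⟨f, hf⟩ : ∃ f, f =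
      - 2 * p ^ 2 * q ^ 2 * d * u₁ * u₂ * a₁ * a₂ * c₁ * c₂ -
      p ^ 2 * q * u₁ ^ 2 * a₁ ^ 2 * c₁ * c₂ - p ^ 2 * q * u₂ ^ 2 * a₂ ^ 2 * c₁ * c₂ +
      p * q ^ 2 * u₁ * u₂ * a₁ ^ 2 * c₁ ^ 2 + p * q ^ 2 * u₁ * u₂ * a₂ ^ 2 * c₂ ^ 2 +
      2 * p * q * d * u₁ ^ 2 * a₁ * a₂ * c₁ ^ 2 + 2 * p * q * d * u₂ ^ 2 * a₁ * a₂ * c₂ ^ 2 +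
      p * u₁ * u₂ * a₁ ^ 2 * c₂ ^ 2 + p * u₁ * u₂ * a₂ ^ 2 * c₁ ^ 2 -
      q * u₁ ^ 2 * a₂ ^ 2 * c₁ * c₂ - q * u₂ ^ 2 * a₁ ^ 2 * c₁ * c₂ -
      2 * d * u₁ * u₂ * a₁ * a₂ * c₁ * c₂ := ⟨_, rfl⟩
  obtain ⟨g, hg⟩ : ∃ g, g =
      - p ^ 2 * q * d * u₁ ^ 2 * a₁ ^ 2 * c₁ * c₂ - p ^ 2 * q * d * u₂ ^ 2 * a₂ ^ 2 * c₁ * c₂ -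
      2 * p ^ 2 * u₁ * u₂ * a₁ * a₂ * c₁ * c₂ + p * q ^ 2 * d * u₁ * u₂ * a₁ ^ 2 * c₁ ^ 2 +
      p * q ^ 2 * d * u₁ * u₂ * a₂ ^ 2 * c₂ ^ 2 + 2 * p * q * u₁ ^ 2 * a₁ * a₂ * c₂ ^ 2 +
      2 * p * q * u₂ ^ 2 * a₁ * a₂ * c₁ ^ 2 + p * d * u₁ * u₂ * a₁ ^ 2 * c₂ ^ 2 +
      p * d * u₁ * u₂ * a₂ ^ 2 * c₁ ^ 2 - 2 * q ^ 2 * u₁ * u₂ * a₁ * a₂ * c₁ * c₂ -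
      q * d * u₁ ^ 2 * a₂ ^ 2 * c₁ * c₂ - q * d * u₂ ^ 2 * a₁ ^ 2 * c₁ * c₂ := ⟨_, rfl⟩
  ext
  · simp only [quadForm, Form.lin, Form.disc23, Prod.fst_add, Prod.smul_fst, smul_eq_mul,
      Prod.fst_zero, mul_zero, zero_mul, mul_one, add_zero, zero_add, sub_zero, zero_sub]
    linear_combination (s * u₁ * c₂ * f * v₁ + u₁ * c₁ * g * v₂) * h₁ -
      (u₂ * c₁ * f * v₁ + s * u₂ * c₂ * g * v₂) * h₂ -
      (s * u₁ * c₂ * v₁ * (p * q' - q * p' + s * d - s * d * p * q * p' * q') -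
        u₂ * c₁ * v₁ * (p * q * d - p * s * p' + q * s * q' - d * p' * q')) * hf -
      (u₁ * c₁ * v₂ * (p * q' - q * p' + s * d - s * d * p * q * p' * q') -
        s * u₂ * c₂ * v₂ * (p * q * d - p * s * p' + q * s * q' - d * p' * q')) * hg
  · simp only [quadForm, Form.lin, Form.disc23, Prod.snd_add, Prod.smul_snd, smul_eq_mul,
      Prod.snd_zero, mul_zero, zero_mul, mul_one, add_zero, zero_add, sub_zero, zero_sub]
    linear_combination (u₂ * c₂ * g * v₁ + s * u₂ * c₁ * f * v₂) * h₁ -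
      (s * u₁ * c₁ * g * v₁ + u₁ * c₂ * f * v₂) * h₂ -
      (s * u₂ * c₁ * v₂ * (p * q' - q * p' + s * d - s * d * p * q * p' * q') -
        u₁ * c₂ * v₂ * (p * q * d - p * s * p' + q * s * q' - d * p' * q')) * hf -
      (u₂ * c₂ * v₁ * (p * q' - q * p' + s * d - s * d * p * q * p' * q') -
        s * u₁ * c₁ * v₁ * (p * q * d - p * s * p' + q * s * q' - d * p' * q')) * hg

/-- The discriminants in the last two slots of the forms with parameters `(p, s, p')` and `(p, q, d)`
are proportional: both are multiples of the biquadratic that relates `√k sn ζ` to `√k sn (ζ + α)`. -/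
theorem disc34_mul_eq
    (h₁ : p * q' - q * p' + s * d - s * d * p * q * p' * q' = 0)
    (h₂ : p * q * d - p * s * p' + q * s * q' - d * p' * q' = 0) (X Y : ℂ × ℂ) :
    q * d * (quadForm p s p').disc34 X Y = s * p' * (quadForm p q d).disc34 X Y := by
  simp only [quadForm, Form.disc34, mul_zero, mul_one, add_zero, zero_add, sub_zero, zero_sub]
  linear_combination (q * s * X.1 * X.2 * Y.1 * Y.2 - d * p' * X.1 * X.2 * Y.1 * Y.2) * h₁ +
    (p * q * d * s * p' - p) * X.1 * X.2 * Y.1 * Y.2 * h₂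

/-- The analogue of `disc34_mul_eq` for `β` in place of `α`. The sign arises because the form with
parameters `(p, q, d)`, with its second and third slot exchanged, is minus the one with parameters
`(q, p, -d)`. -/
theorem disc34_mul_eq'
    (h₁ : p * q' - q * p' + s * d - s * d * p * q * p' * q' = 0)
    (h₂ : p * q * d - p * s * p' + q * s * q' - d * p' * q' = 0) (X Y : ℂ × ℂ) :
    p * d * (quadForm q s q').disc34 X Y = -(s * q') * (quadForm p q d).disc13 X Y := by
  simp only [quadForm, Form.disc34, Form.disc13, mul_zero, zero_mul, mul_one,
    add_zero, zero_add, sub_zero, zero_sub]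
  linear_combination (p * s * X.1 * X.2 * Y.1 * Y.2 + d * q' * X.1 * X.2 * Y.1 * Y.2) * h₁ +
    (-(p * q * d * s * q') - q) * X.1 * X.2 * Y.1 * Y.2 * h₂

theorem disc34_lin_eq (p q d : ℂ) (U A C : ℂ × ℂ) :
    (quadForm p q d).disc34 ((quadForm p q d).lin A U C) C =
      (quadForm p q d).disc23 U C * (quadForm p q d).disc13 A C := by
  simp only [quadForm, Form.disc34, Form.disc13, Form.disc23, Form.lin, mul_zero, zero_mul, mul_one,
    add_zero, zero_add, sub_zero, zero_sub]
  ring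

/-- For `d = 0` the parameters agree up to one common sign. -/
theorem exists_sign_of_eq_zero (hs : s ≠ 0) (hp' : p' ≠ 0)
    (h₁ : p * q' - q * p' = 0) (h₂ : -(p * s * p') + q * s * q' = 0) (hpq : p ≠ 0 ∨ q ≠ 0) :
    ∃ ε : ℂ, ε ^ 2 = 1 ∧ q = ε * p ∧ q' = ε * p' := by
  have h₃ : q * q' = p * p' := mul_left_cancel₀ hs (by linear_combination h₂)
  have hq' : q' ^ 2 = p' ^ 2 := by
    have e1 : p * (q' ^ 2 - p' ^ 2) = 0 := by linear_combination q' * h₁ + p' * h₃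
    have e2 : q * (q' ^ 2 - p' ^ 2) = 0 := by linear_combination p' * h₁ + q' * h₃
    rcases hpq with h | h
    · exact sub_eq_zero.1 ((mul_eq_zero.1 e1).resolve_left h)
    · exact sub_eq_zero.1 ((mul_eq_zero.1 e2).resolve_left h)
  refine ⟨q' / p', by rw [div_pow, hq', div_self (pow_ne_zero 2 hp')], ?_, by field_simp⟩
  field_simp
  linear_combination -h₁

/-- How the discriminant of the second step changes between the two ways around the square, with the
unnormalised solution `Q(U, A, Z, C) = 0` as in `lin_lin_add_disc23_smul`. -/
theorem disc34_lin_mul_eq (hs : s ≠ 0) (hp' : p' ≠ 0)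
    (h₁ : p * q' - q * p' + s * d - s * d * p * q * p' * q' = 0)
    (h₂ : p * q * d - p * s * p' + q * s * q' - d * p' * q' = 0) (U A C : ℂ × ℂ) :
    q * q' * (quadForm p s p').disc34 ((quadForm p q d).lin A U C) C =
      -(p * p' * (quadForm p q d).disc23 U C * (quadForm q s q').disc34 A C) := by
  by_cases hd : d = 0
  · subst hd
    by_cases hpq : p ≠ 0 ∨ q ≠ 0
    · obtain ⟨ε, hε, rfl, rfl⟩ := exists_sign_of_eq_zero
        (p := p) (q := q) (q' := q') hs hp'
        (by linear_combination h₁) (by linear_combination h₂) hpq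
      simp only [quadForm, Form.disc34, Form.disc23, Form.lin, mul_zero, zero_mul, mul_one,
        add_zero, zero_add, sub_zero, zero_sub]
      rcases (show ε = 1 ∨ ε = -1 from by simpa using hε) with rfl | rfl <;> ring
    · push Not at hpq
      rw [hpq.1, hpq.2]; ring
  · apply mul_left_cancel₀ hd
    linear_combination q' * disc34_mul_eq h₁ h₂ ((quadForm p q d).lin A U C) C +
      p' * (quadForm p q d).disc23 U C * disc34_mul_eq' h₁ h₂ A C +
      s * p' * q' * disc34_lin_eq p q d U A C

/-- If `Q(U, A, Y, C)` vanishes for all `Y`, then the bilinear form `Q(·, A, ·, C)` is degenerate. -/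
theorem disc13_eq_zero_of_lin_eq_zero {U A C : ℂ × ℂ} (hU : U ≠ 0)
    (h : (quadForm p q d).lin A U C = 0) : (quadForm p q d).disc13 A C = 0 := by
  have z₀ : quadForm p q d A U C (0, 1) = 0 := by simpa [Form.lin] using congrArg Prod.fst h
  have z₁ : quadForm p q d A U C (1, 0) = 0 := by simpa [Form.lin] using congrArg Prod.snd h
  have e : ∀ Y, quadForm p q d A U C Y =
      U.1 * quadForm p q d (1, 0) A Y C + U.2 * quadForm p q d (0, 1) A Y C := fun Y => by
    simp only [quadForm]; ring
  rw [e] at z₀ z₁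
  have e₁ : (quadForm p q d).disc13 A C * U.1 = 0 := by
    rw [Form.disc13]
    linear_combination quadForm p q d (0, 1) A (1, 0) C * z₀ -
      quadForm p q d (0, 1) A (0, 1) C * z₁
  have e₂ : (quadForm p q d).disc13 A C * U.2 = 0 := by
    rw [Form.disc13]
    linear_combination quadForm p q d (1, 0) A (0, 1) C * z₁ -
      quadForm p q d (1, 0) A (1, 0) C * z₀
  by_contra hne
  exact hU (Prod.ext ((mul_eq_zero.1 e₁).resolve_left hne) ((mul_eq_zero.1 e₂).resolve_left hne))

theorem disc34_eq_zero_of_lin_eq_zero {U A C : ℂ × ℂ} (hC : C ≠ 0)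
    (h : (quadForm p q d).lin A U C = 0) : (quadForm p q d).disc34 U A = 0 := by
  have e : ∀ V, (quadForm p q d).disc34 U A * hsub C V = 0 := fun V => by
    have e₁ := hsub_lin_lin p q d A U C V
    have e₂ : (quadForm p q d).disc34 A U = (quadForm p q d).disc34 U A := by
      simp only [quadForm, Form.disc34]; ring
    rw [h, e₂] at e₁
    simp only [hsub, Prod.fst_zero, Prod.snd_zero] at e₁ ⊢
    linear_combination e₁
  by_contra hne
  refine hC (Prod.ext ?_ ?_)
  · simpa [hsub, hne] using e (0, 1)
  · simpa [hsub, hne] using e (1, 0)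

/-- The two ways around an elementary square, applied to `V`, agree after scaling by the
discriminants of their second steps. -/
theorem lin_lin_comm (hs : s ≠ 0) (hp' : p' ≠ 0)
    (h₁ : p * q' - q * p' + s * d - s * d * p * q * p' * q' = 0)
    (h₂ : p * q * d - p * s * p' + q * s * q' - d * p' * q' = 0)
    {U A B C : ℂ × ℂ} (hU : U ≠ 0) (hA : A ≠ 0) (hB : B ≠ 0)
    (hC : C ≠ 0)
    (hF : quadForm p q d U A B C = 0)
    (hUA : (quadForm p s p').disc34 U A ≠ 0) (hAC : (quadForm q s q').disc34 A C ≠ 0)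
    (V : ℂ × ℂ) :
    (p * p' * (quadForm q s q').disc34 A C) •
        (quadForm p s p').lin B C ((quadForm q s q').lin U B V) =
      (q * q' * (quadForm p s p').disc34 B C) •
        (quadForm q s q').lin A C ((quadForm p s p').lin U A V) := by
  have hZ : hsub ((quadForm p q d).lin A U C) B = 0 := by
    rw [quadForm_swap, quadForm_eq_hsub] at hF
    simp only [hsub] at hF ⊢
    linear_combination -hF
  obtain ⟨ρ, hρ⟩ := exists_smul_of_hsub_eq_zero hB hZ
  have e₁ := lin_lin_add_disc23_smul h₁ h₂ U A C V
  have e₂ := disc34_lin_mul_eq hs hp' h₁ h₂ U A C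
  rw [hρ] at e₁ e₂
  simp only [lin_smul, lin_smul_fst, lin_smul_snd, disc34_smul_fst] at e₁ e₂
  -- For `ρ = 0` the equation `Q(U, A, Y, C) = 0` holds for all `Y`. As the discriminants do not
  -- vanish, this forces `p = q = 0`, or `d = 0` with `C` equal to `U` up to sign.
  by_cases hρ0 : ρ = 0
  · by_cases hpq : p ≠ 0 ∨ q ≠ 0
    · subst hρ0
      rw [zero_smul] at hρ
      have z₀ : quadForm p q d A U C (0, 1) = 0 := by simpa [Form.lin] using congrArg Prod.fst hρ
      have z₁ : quadForm p q d A U C (1, 0) = 0 := by simpa [Form.lin] using congrArg Prod.snd hρ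
      have hd : d = 0 := by
        have hp : p = 0 ∨ d = 0 := by
          have e := disc34_mul_eq' h₁ h₂ A C
          rw [disc13_eq_zero_of_lin_eq_zero hU hρ, mul_zero] at e
          simpa [hAC] using e
        have hq : q = 0 ∨ d = 0 := by
          have e := disc34_mul_eq h₁ h₂ U A
          rw [disc34_eq_zero_of_lin_eq_zero hC hρ, mul_zero] at e
          simpa [hUA] using e
        tauto
      subst hd
      obtain ⟨ε, hε, rfl, rfl⟩ := exists_sign_of_eq_zero
        (p := p) (q := q) (q' := q') hs hp'
        (by linear_combination h₁) (by linear_combination h₂) hpq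
      have hp : p ≠ 0 := by
        rintro rfl
        simp at hpq
      have hUC : hsub C (ε * U.1, U.2) = 0 := by
        by_contra hne
        simp only [hsub] at hne
        simp only [quadForm] at z₀ z₁
        refine hA (Prod.ext ?_ ?_)
        · apply (mul_eq_zero.1 _).resolve_right (mul_ne_zero hp hne)
          linear_combination -ε * z₀ - p * A.1 * C.1 * U.2 * hε
        · apply (mul_eq_zero.1 _).resolve_right (mul_ne_zero hp hne)
          linear_combination z₁
      have hεU : (ε * U.1, U.2) ≠ 0 := fun h0 => hU <| by
        simp only [Prod.mk_eq_zero, mul_eq_zero] at h0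
        exact Prod.ext (h0.1.resolve_left (by rintro rfl; simp at hε)) h0.2
      obtain ⟨c, rfl⟩ := exists_smul_of_hsub_eq_zero hεU hUC
      simp only [quadForm, Form.disc34, Form.lin, Prod.smul_mk, smul_eq_mul, mul_zero,
        mul_one, add_zero, zero_add, sub_zero, zero_sub]
      rcases (show ε = 1 ∨ ε = -1 by simpa using hε) with rfl | rfl <;>
        refine Prod.ext ?_ ?_ <;> ring
    · push Not at hpq
      rw [hpq.1, hpq.2]; simp
  · have hρ2 : ρ ^ 2 ≠ 0 := pow_ne_zero 2 hρ0
    generalize (quadForm p s p').lin B C ((quadForm q s q').lin U B V) = X at e₁ ⊢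
    generalize (quadForm q s q').lin A C ((quadForm p s p').lin U A V) = Y at e₁ ⊢
    have a := congrArg Prod.fst e₁
    have b := congrArg Prod.snd e₁
    simp only [Prod.fst_add, Prod.smul_fst, Prod.snd_add, Prod.smul_snd, smul_eq_mul,
      Prod.fst_zero, Prod.snd_zero] at a b
    ext <;> apply mul_left_cancel₀ hρ2
    · simp only [Prod.smul_fst, smul_eq_mul]
      linear_combination p * p' * (quadForm q s q').disc34 A C * a - Y.1 * e₂
    · simp only [Prod.smul_snd, smul_eq_mul]
      linear_combination p * p' * (quadForm q s q').disc34 A C * b - Y.2 * e₂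

end

/-! ### Theta functions: products and addition formulas -/

section

open Complex

/-- The index set `ℤ²` splits into the pairs of equal parity and those of different parity. -/
noncomputable def parityEquiv : (ℤ × ℤ) ⊕ (ℤ × ℤ) ≃ ℤ × ℤ :=
  Equiv.ofBijective
    (Sum.elim (fun x => (x.1 + x.2, x.1 - x.2)) (fun x => (x.1 + x.2 + 1, x.1 - x.2))) <| by
    constructor
    · rintro (⟨a, b⟩ | ⟨a, b⟩) (⟨c, d⟩ | ⟨c, d⟩) h <;>
        simp only [Sum.elim_inl, Sum.elim_inr, Prod.mk.injEq] at h <;>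
        simp only [Sum.inl.injEq, Sum.inr.injEq, Prod.mk.injEq, reduceCtorEq] <;> omega
    · rintro ⟨m, n⟩
      rcases Int.even_or_odd (m + n) with ⟨a, ha⟩ | ⟨a, ha⟩
      · exact ⟨.inl (a, m - a), Prod.ext (by simp) (by simp; omega)⟩
      · exact ⟨.inr (a, m - a - 1), Prod.ext (by simp; omega) (by simp; omega)⟩

theorem parityEquiv_inl (a b : ℤ) : parityEquiv (.inl (a, b)) = (a + b, a - b) := rfl

theorem parityEquiv_inr (a b : ℤ) : parityEquiv (.inr (a, b)) = (a + b + 1, a - b) := rfl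

variable {τ : ℂ}

/-- Together with `dTheta1` a basis, consisting of theta functions with quasi-period `2 * τ`, in which
the products `θᵢ(x + y) θᵢ(x - y)` are bilinear. -/
noncomputable def dTheta0 (τ x : ℂ) : ℂ := theta3 (2 * τ) (2 * x)

/-- See `dTheta0`. -/
noncomputable def dTheta1 (τ x : ℂ) : ℂ := theta2 (2 * τ) (2 * x)

theorem hasSum_mul_of_hasSum {f g : ℤ → ℂ} {a b : ℂ} (hf : HasSum f a) (hg : HasSum g b) :
    HasSum (fun m : ℤ × ℤ => f m.1 * g m.2) (a * b) :=
  hf.mul hg (summable_mul_of_summable_norm hf.summable.norm hg.summable.norm)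

theorem hasSum_jacobiTheta₂_term_mul (hτ : 0 < τ.im) (z w : ℂ) :
    HasSum (fun m : ℤ × ℤ => jacobiTheta₂_term m.1 z τ * jacobiTheta₂_term m.2 w τ)
      (jacobiTheta₂ z τ * jacobiTheta₂ w τ) := by
  have h := hasSum_mul_of_hasSum (hasSum_jacobiTheta₂_term z hτ) (hasSum_jacobiTheta₂_term w hτ)
  exact h

/-- The double series is split by the parity of the sum of the two indices. The products of the other
theta functions follow from this one by half-period shifts. -/
theorem theta3_mul (hτ : 0 < τ.im) (x y : ℂ) :
    theta3 τ (x + y) * theta3 τ (x - y) =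
      dTheta0 τ x * dTheta0 τ y + dTheta1 τ x * dTheta1 τ y := by
  have hτ2 : 0 < (2 * τ).im := by simpa using hτ
  have e : dTheta1 τ x * dTheta1 τ y =
      exp (Real.pi * I * τ + 2 * Real.pi * I * (x + y)) *
        (jacobiTheta₂ (2 * x + τ) (2 * τ) * jacobiTheta₂ (2 * y + τ) (2 * τ)) := by
    simp only [dTheta1, theta2, mul_div_cancel_left₀ τ (two_ne_zero' ℂ)]
    rw [mul_mul_mul_comm, ← Complex.exp_add]
    ring_nf
  rw [e]
  have h₀ := hasSum_jacobiTheta₂_term_mul hτ2 (2 * x) (2 * y)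
  have h₁ := (hasSum_jacobiTheta₂_term_mul hτ2 (2 * x + τ) (2 * y + τ)).mul_left
    (exp (Real.pi * I * τ + 2 * Real.pi * I * (x + y)))
  have h := parityEquiv.hasSum_iff.2 (hasSum_jacobiTheta₂_term_mul hτ (x + y) (x - y))
  refine h.unique (HasSum.sum ?_ ?_)
  · refine (congrArg (HasSum · _) (funext fun m => ?_)).mp h₀
    obtain ⟨a, b⟩ := m
    simp only [Function.comp_apply, parityEquiv_inl, jacobiTheta₂_term, ← Complex.exp_add]
    push_cast
    ring_nf
  · refine (congrArg (HasSum · _) (funext fun m => ?_)).mp h₁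
    obtain ⟨a, b⟩ := m
    simp only [Function.comp_apply, parityEquiv_inr, jacobiTheta₂_term, ← Complex.exp_add]
    push_cast
    ring_nf

theorem exp_add_pi_mul_I (z : ℂ) : exp (z + Real.pi * I) = -exp z := by
  rw [Complex.exp_add, Complex.exp_pi_mul_I]; ring

theorem dTheta0_add_half (x : ℂ) : dTheta0 τ (x + 1 / 2) = dTheta0 τ x := by
  simp only [dTheta0, theta3]
  rw [show 2 * (x + 1 / 2) = 2 * x + 1 by ring, jacobiTheta₂_add_left]

theorem dTheta1_add_half (x : ℂ) : dTheta1 τ (x + 1 / 2) = -dTheta1 τ x := by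
  simp only [dTheta1, theta2]
  rw [show 2 * (x + 1 / 2) + 2 * τ / 2 = 2 * x + 2 * τ / 2 + 1 by ring, jacobiTheta₂_add_left,
    show Real.pi * I * (2 * τ) / 4 + Real.pi * I * (2 * (x + 1 / 2)) =
      Real.pi * I * (2 * τ) / 4 + Real.pi * I * (2 * x) + Real.pi * I by ring, exp_add_pi_mul_I]
  ring

/-- The factor `exp (π i τ / 4 + π i x)` of `theta2`, which turns `theta3` shifted by `τ / 2` into
`theta2`. -/
theorem exp_mul_dTheta0_add (x : ℂ) :
    exp (Real.pi * I * τ / 4 + Real.pi * I * x) ^ 2 * dTheta0 τ (x + τ / 2) = dTheta1 τ x := by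
  simp only [dTheta0, dTheta1, theta3, theta2, ← Complex.exp_nat_mul]
  ring_nf

theorem exp_mul_dTheta1_add (x : ℂ) :
    exp (Real.pi * I * τ / 4 + Real.pi * I * x) ^ 2 * dTheta1 τ (x + τ / 2) = dTheta0 τ x := by
  simp only [dTheta0, dTheta1, theta3, theta2, ← Complex.exp_nat_mul]
  rw [show 2 * (x + τ / 2) + 2 * τ / 2 = 2 * x + 2 * τ by ring, jacobiTheta₂_add_left',
    ← mul_assoc, ← mul_assoc, ← Complex.exp_add, ← Complex.exp_add]
  convert one_mul _
  rw [← Complex.exp_zero]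
  congr 1
  push_cast
  ring

theorem theta2_eq (v : ℂ) :
    theta2 τ v = exp (Real.pi * I * τ / 4 + Real.pi * I * v) * theta3 τ (v + τ / 2) := rfl

theorem theta1_eq (v : ℂ) : theta1 τ v = -theta2 τ (v + 1 / 2) := by
  have : exp (Real.pi * I * τ / 4 + Real.pi * I * (v + 1 / 2)) =
      exp (Real.pi * I * τ / 4 + Real.pi * I * v) * I := by
    rw [mul_add, ← add_assoc, Complex.exp_add,
      show Real.pi * I * (1 / 2) = Real.pi / 2 * I by ring, Complex.exp_pi_div_two_mul_I]
  simp only [theta1, theta2, this]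
  rw [show v + 1 / 2 + τ / 2 = v + τ / 2 + 1 / 2 by ring]
  ring

theorem theta4_mul (hτ : 0 < τ.im) (x y : ℂ) :
    theta4 τ (x + y) * theta4 τ (x - y) =
      dTheta0 τ x * dTheta0 τ y - dTheta1 τ x * dTheta1 τ y := by
  have h := theta3_mul hτ (x + 1 / 2) y
  rw [dTheta0_add_half, dTheta1_add_half] at h
  simp only [theta4, theta3] at h ⊢
  rw [show x + y + 1 / 2 = x + 1 / 2 + y by ring, show x - y + 1 / 2 = x + 1 / 2 - y by ring, h]
  ring

theorem theta2_mul (hτ : 0 < τ.im) (x y : ℂ) :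
    theta2 τ (x + y) * theta2 τ (x - y) =
      dTheta1 τ x * dTheta0 τ y + dTheta0 τ x * dTheta1 τ y := by
  have h := theta3_mul hτ (x + τ / 2) y
  rw [← exp_mul_dTheta0_add x, ← exp_mul_dTheta1_add x]
  have e : exp (Real.pi * I * τ / 4 + Real.pi * I * (x + y)) *
      exp (Real.pi * I * τ / 4 + Real.pi * I * (x - y)) =
      exp (Real.pi * I * τ / 4 + Real.pi * I * x) ^ 2 := by
    rw [← Complex.exp_add, ← Complex.exp_nat_mul]
    ring_nf
  rw [theta2_eq, theta2_eq, show x + y + τ / 2 = x + τ / 2 + y by ring,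
    show x - y + τ / 2 = x + τ / 2 - y by ring, mul_mul_mul_comm, e, h]
  ring

theorem theta1_mul (hτ : 0 < τ.im) (x y : ℂ) :
    theta1 τ (x + y) * theta1 τ (x - y) =
      dTheta0 τ x * dTheta1 τ y - dTheta1 τ x * dTheta0 τ y := by
  have h := theta2_mul hτ (x + 1 / 2) y
  rw [dTheta0_add_half, dTheta1_add_half] at h
  rw [theta1_eq, theta1_eq, show x + y + 1 / 2 = x + 1 / 2 + y by ring,
    show x - y + 1 / 2 = x + 1 / 2 - y by ring, neg_mul_neg, h]
  ring

/-- Four-term addition formula of Weierstrass type. -/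
theorem theta_add₁ (hτ : 0 < τ.im) (a b c : ℂ) :
    theta4 τ a * theta4 τ b * (theta4 τ c * theta4 τ (a + b + c)) +
      theta1 τ a * theta1 τ b * (theta1 τ c * theta1 τ (a + b + c)) =
    theta4 τ 0 * theta4 τ (a + b) * (theta4 τ (b + c) * theta4 τ (a + c)) := by
  have h₁ := theta4_mul hτ ((a + b) / 2) ((a - b) / 2)
  have h₂ := theta4_mul hτ ((a + b) / 2 + c) ((a + b) / 2)
  have h₃ := theta1_mul hτ ((a + b) / 2) ((a - b) / 2)
  have h₄ := theta1_mul hτ ((a + b) / 2 + c) ((a + b) / 2)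
  have h₅ := theta4_mul hτ ((a + b) / 2) ((a + b) / 2)
  have h₆ := theta4_mul hτ ((a + b) / 2 + c) ((a - b) / 2)
  rw [show (a + b) / 2 + (a - b) / 2 = a by ring, show (a + b) / 2 - (a - b) / 2 = b by ring]
    at h₁ h₃
  rw [show (a + b) / 2 + c + (a + b) / 2 = a + b + c by ring,
    show (a + b) / 2 + c - (a + b) / 2 = c by ring] at h₂ h₄
  rw [show (a + b) / 2 + (a + b) / 2 = a + b by ring, sub_self] at h₅
  rw [show (a + b) / 2 + c + (a - b) / 2 = a + c by ring,
    show (a + b) / 2 + c - (a - b) / 2 = b + c by ring] at h₆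
  rw [mul_comm (theta4 τ c), mul_comm (theta1 τ c), mul_comm (theta4 τ 0),
    mul_comm (theta4 τ (b + c)), h₁, h₂, h₃, h₄, h₅, h₆]
  ring

/-- The companion of `theta_add₁` with two factors `θ₁` and two factors `θ₄` in each term. -/
theorem theta_add₂ (hτ : 0 < τ.im) (a b c : ℂ) :
    theta1 τ a * theta4 τ b * (theta1 τ c * theta4 τ (a + b + c)) +
      theta4 τ a * theta1 τ b * (theta4 τ c * theta1 τ (a + b + c)) =
    theta4 τ 0 * theta4 τ (a + c) * (theta1 τ (a + b) * theta1 τ (b + c)) := by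
  have h₁ := theta1_mul hτ ((a + c) / 2) ((a - c) / 2)
  have h₂ := theta4_mul hτ ((a + c) / 2 + b) ((a + c) / 2)
  have h₃ := theta4_mul hτ ((a + c) / 2) ((a - c) / 2)
  have h₄ := theta1_mul hτ ((a + c) / 2 + b) ((a + c) / 2)
  have h₅ := theta4_mul hτ ((a + c) / 2) ((a + c) / 2)
  have h₆ := theta1_mul hτ ((a + c) / 2 + b) ((a - c) / 2)
  rw [show (a + c) / 2 + (a - c) / 2 = a by ring, show (a + c) / 2 - (a - c) / 2 = c by ring]
    at h₁ h₃
  rw [show (a + c) / 2 + b + (a + c) / 2 = a + b + c by ring,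
    show (a + c) / 2 + b - (a + c) / 2 = b by ring] at h₂ h₄
  rw [show (a + c) / 2 + (a + c) / 2 = a + c by ring, sub_self] at h₅
  rw [show (a + c) / 2 + b + (a - c) / 2 = a + b by ring,
    show (a + c) / 2 + b - (a - c) / 2 = b + c by ring] at h₆
  rw [show ∀ A B C D : ℂ, A * B * (C * D) = A * C * (D * B) by intros; ring, h₁, h₂,
    show ∀ A B C D : ℂ, A * B * (C * D) = A * C * (D * B) by intros; ring, h₃, h₄,
    mul_comm (theta4 τ 0), h₅, h₆]
  ring

/-! ### Zeros of theta functions -/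

theorem differentiable_theta3 (hτ : 0 < τ.im) : Differentiable ℂ (theta3 τ) := fun z =>
  differentiableAt_jacobiTheta₂_fst z hτ

theorem differentiable_theta4 (hτ : 0 < τ.im) : Differentiable ℂ (theta4 τ) :=
  (differentiable_theta3 hτ).comp (differentiable_id.add_const _)

theorem differentiable_theta2 (hτ : 0 < τ.im) : Differentiable ℂ (theta2 τ) := by
  have h := (differentiable_theta3 hτ).comp (differentiable_id.add_const (τ / 2))
  have e : Differentiable ℂ fun v : ℂ => exp (Real.pi * I * τ / 4 + Real.pi * I * v) := by fun_prop
  exact e.mul h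

theorem differentiable_theta1 (hτ : 0 < τ.im) : Differentiable ℂ (theta1 τ) := by
  have : theta1 τ = fun v => -theta2 τ (v + 1 / 2) := funext theta1_eq
  rw [this]
  exact ((differentiable_theta2 hτ).comp (differentiable_id.add_const _)).neg

theorem eq_zero_or_eq_zero_of_mul_eq_zero {f g : ℂ → ℂ} (hf : Differentiable ℂ f)
    (hg : Differentiable ℂ g) (h : ∀ z, f z * g z = 0) : (∀ z, f z = 0) ∨ ∀ z, g z = 0 := by
  have := AnalyticOnNhd.eq_zero_or_eq_zero_of_mul_eq_zero (U := Set.univ)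
    (fun z _ => hf.analyticAt z) (fun z _ => hg.analyticAt z) (fun z _ => h z)
    isPreconnected_univ
  simpa using this

/-- Two entire functions with proportional squares are proportional, so that they vanish if they
acquire different factors under a translation. -/
theorem eq_zero_of_sq_eq {f g m : ℂ → ℂ} (hf : Differentiable ℂ f) (hg : Differentiable ℂ g)
    {t c : ℂ} (hft : ∀ z, f (z + t) = -(m z * f z)) (hgt : ∀ z, g (z + t) = m z * g z)
    (hm : ∀ z, m z ≠ 0) (h : ∀ z, f z ^ 2 = c * g z ^ 2) (z : ℂ) : f z = 0 := by
  obtain ⟨b, rfl⟩ : ∃ b, c = b ^ 2 := ⟨c ^ (1 / 2 : ℂ), by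
    rw [← Complex.cpow_nat_mul]; norm_num⟩
  have aux : ∀ b : ℂ, (∀ z, f z - b * g z = 0) → f z = 0 := fun b hb => by
    have e := hb (z + t)
    rw [hft, hgt] at e
    have : m z * f z = 0 := by linear_combination (-e + m z * hb z) / 2
    exact (mul_eq_zero.1 this).resolve_left (hm z)
  rcases eq_zero_or_eq_zero_of_mul_eq_zero (f := fun z => f z - b * g z)
    (g := fun z => f z - (-b) * g z) (hf.sub (hg.const_mul b)) (hf.sub (hg.const_mul (-b)))
    (fun z => by linear_combination h z) with h' | h'
  · exact aux b h'
  · exact aux (-b) h'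

/-- The constant Fourier coefficient of `θ₃` is `1`. -/
theorem exists_theta3_ne_zero (hτ : 0 < τ.im) : ∃ z, theta3 τ z ≠ 0 := by
  by_contra! h
  have hs : HasSum (fun n : ℤ => ∫ x in (0 : ℝ)..1, jacobiTheta₂_term n x τ)
      (∫ x in (0 : ℝ)..1, jacobiTheta₂ x τ) := by
    refine intervalIntegral.hasSum_integral_of_dominated_convergence
      (fun n _ => ‖jacobiTheta₂_term n 0 τ‖) ?_ ?_ ?_ ?_ ?_
    · intro n
      refine Continuous.aestronglyMeasurable ?_
      unfold jacobiTheta₂_term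
      fun_prop
    · intro n
      refine Filter.Eventually.of_forall fun x _ => ?_
      simp [norm_jacobiTheta₂_term]
    · exact Filter.Eventually.of_forall fun x _ => (hasSum_jacobiTheta₂_term 0 hτ).summable.norm
    · simp
    · exact Filter.Eventually.of_forall fun x _ => hasSum_jacobiTheta₂_term x hτ
  have h0 : ∀ n : ℤ, n ≠ 0 → ∫ x in (0 : ℝ)..1, jacobiTheta₂_term n x τ = 0 := by
    intro n hn
    have hc : 2 * Real.pi * I * n ≠ 0 := by simp [hn, Real.pi_ne_zero]
    simp only [jacobiTheta₂_term, Complex.exp_add]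
    rw [intervalIntegral.integral_mul_const, integral_exp_mul_complex hc]
    have : exp (2 * Real.pi * I * n * (1 : ℝ)) = 1 := by
      rw [Complex.exp_eq_one_iff]
      exact ⟨n, by push_cast; ring⟩
    rw [this]
    simp
  have h1 := hs.unique (hasSum_single 0 h0)
  have h2 : ∀ x : ℝ, jacobiTheta₂ x τ = 0 := fun x => h x
  simp [jacobiTheta₂_term, h2] at h1

theorem theta3_add_one (v : ℂ) : theta3 τ (v + 1) = theta3 τ v := jacobiTheta₂_add_left v τ

theorem theta4_add_one (v : ℂ) : theta4 τ (v + 1) = theta4 τ v := by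
  simp only [theta4]; rw [add_right_comm, jacobiTheta₂_add_left]

theorem theta2_add_one (v : ℂ) : theta2 τ (v + 1) = -theta2 τ v := by
  rw [theta2_eq, theta2_eq, add_right_comm, theta3_add_one, mul_add, ← add_assoc, mul_one,
    exp_add_pi_mul_I]
  ring

theorem theta1_add_one (v : ℂ) : theta1 τ (v + 1) = -theta1 τ v := by
  rw [theta1_eq, theta1_eq, add_right_comm, theta2_add_one]

theorem theta3_add_tau (v : ℂ) :
    theta3 τ (v + τ) = exp (-Real.pi * I * (τ + 2 * v)) * theta3 τ v :=
  jacobiTheta₂_add_left' v τ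

theorem theta4_add_tau (v : ℂ) :
    theta4 τ (v + τ) = -(exp (-Real.pi * I * (τ + 2 * v)) * theta4 τ v) := by
  simp only [theta4]
  rw [add_right_comm, jacobiTheta₂_add_left', ← neg_mul]
  congr 1
  rw [← exp_add_pi_mul_I, Complex.exp_eq_exp_iff_exists_int]
  exact ⟨-1, by push_cast; ring⟩

theorem exists_theta4_ne_zero (hτ : 0 < τ.im) : ∃ z, theta4 τ z ≠ 0 := by
  obtain ⟨z, hz⟩ := exists_theta3_ne_zero hτ
  exact ⟨z - 1 / 2, by simpa [theta4, theta3] using hz⟩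

theorem exists_theta2_ne_zero (hτ : 0 < τ.im) : ∃ z, theta2 τ z ≠ 0 := by
  obtain ⟨z, hz⟩ := exists_theta3_ne_zero hτ
  exact ⟨z - τ / 2, by rw [theta2_eq]; simpa using hz⟩

theorem exists_theta1_ne_zero (hτ : 0 < τ.im) : ∃ z, theta1 τ z ≠ 0 := by
  obtain ⟨z, hz⟩ := exists_theta2_ne_zero hτ
  exact ⟨z - 1 / 2, by simpa [theta1_eq] using hz⟩

theorem theta1_neg (hτ : 0 < τ.im) (v : ℂ) : theta1 τ (-v) = -theta1 τ v := by
  obtain ⟨z, hz⟩ := exists_theta1_ne_zero hτ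
  have h := theta1_mul hτ ((z + v) / 2) ((z - v) / 2)
  have h' := theta1_mul hτ ((z - v) / 2) ((z + v) / 2)
  rw [show (z + v) / 2 + (z - v) / 2 = z by ring, show (z + v) / 2 - (z - v) / 2 = v by ring] at h
  rw [show (z - v) / 2 + (z + v) / 2 = z by ring, show (z - v) / 2 - (z + v) / 2 = -v by ring] at h'
  apply mul_left_cancel₀ hz
  linear_combination h + h'

/-- If `θ₄(0) = 0`, then `θ₁ ^ 2` and `θ₄ ^ 2` are proportional, which the period `1` excludes. -/
theorem theta4_zero_ne_zero (hτ : 0 < τ.im) : theta4 τ 0 ≠ 0 := by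
  intro h
  have h4 := fun x => theta4_mul hτ x 0
  have h3 := fun x => theta3_mul hτ x 0
  have h1 := fun x => theta1_mul hτ x 0
  simp only [add_zero, sub_zero] at h4 h3 h1
  have e := h4 0
  rw [h] at e
  by_cases h0 : dTheta0 τ 0 = 0
  · obtain ⟨z, hz⟩ := exists_theta3_ne_zero hτ
    have h0' : dTheta1 τ 0 = 0 := by simpa [h0] using e
    have := h3 z
    simp [h0, h0', hz] at this
  · obtain ⟨z, hz⟩ := exists_theta1_ne_zero hτ
    refine hz (eq_zero_of_sq_eq (m := fun _ => 1) (t := 1) (c := dTheta1 τ 0 / dTheta0 τ 0)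
      (differentiable_theta1 hτ) (differentiable_theta4 hτ) (fun z => ?_) (fun z => ?_)
      (fun _ => one_ne_zero) (fun z => ?_) z)
    · rw [theta1_add_one, one_mul]
    · rw [theta4_add_one, one_mul]
    · rw [sq, sq, h4, h1]
      field_simp
      linear_combination dTheta1 τ z * e

/-- If `θ₃(0) = 0`, then `θ₂ ^ 2` and `θ₄ ^ 2` are proportional, which the period `1` excludes. -/
theorem theta3_zero_ne_zero (hτ : 0 < τ.im) : theta3 τ 0 ≠ 0 := by
  intro h
  have h4 := fun x => theta4_mul hτ x 0
  have h3 := fun x => theta3_mul hτ x 0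
  have h2 := fun x => theta2_mul hτ x 0
  simp only [add_zero, sub_zero] at h4 h3 h2
  have e := h3 0
  rw [h] at e
  by_cases h0 : dTheta0 τ 0 = 0
  · obtain ⟨z, hz⟩ := exists_theta3_ne_zero hτ
    have h0' : dTheta1 τ 0 = 0 := by simpa [h0] using e
    have := h3 z
    simp [h0, h0', hz] at this
  · obtain ⟨z, hz⟩ := exists_theta2_ne_zero hτ
    refine hz (eq_zero_of_sq_eq (m := fun _ => 1) (t := 1) (c := dTheta1 τ 0 / dTheta0 τ 0)
      (differentiable_theta2 hτ) (differentiable_theta4 hτ) (fun z => ?_) (fun z => ?_)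
      (fun _ => one_ne_zero) (fun z => ?_) z)
    · rw [theta2_add_one, one_mul]
    · rw [theta4_add_one, one_mul]
    · rw [sq, sq, h4, h2]
      field_simp
      linear_combination -dTheta1 τ z * e

/-- If `θ₂(0) = 0`, then `θ₄ ^ 2` and `θ₃ ^ 2` are proportional, which the quasi-period `τ`
excludes. -/
theorem theta2_zero_ne_zero (hτ : 0 < τ.im) : theta2 τ 0 ≠ 0 := by
  intro h
  have h4 := fun x => theta4_mul hτ x 0
  have h3 := fun x => theta3_mul hτ x 0
  have h2 := theta2_mul hτ 0 0
  simp only [add_zero, sub_zero] at h4 h3 h2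
  obtain ⟨z, hz⟩ := exists_theta4_ne_zero hτ
  have h0 : dTheta0 τ 0 = 0 ∨ dTheta1 τ 0 = 0 := by
    rw [← mul_eq_zero]
    rw [h] at h2
    linear_combination -h2 / 2
  obtain ⟨c, hc⟩ : ∃ c, ∀ z, theta4 τ z ^ 2 = c * theta3 τ z ^ 2 := by
    rcases h0 with h0 | h0
    · exact ⟨-1, fun z => by rw [sq, sq, h4, h3, h0]; ring⟩
    · exact ⟨1, fun z => by rw [sq, sq, h4, h3, h0]; ring⟩
  exact hz (eq_zero_of_sq_eq (differentiable_theta4 hτ) (differentiable_theta3 hτ)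
    theta4_add_tau theta3_add_tau (fun _ => Complex.exp_ne_zero _) hc z)

theorem theta1_ne_zero_of_theta4_eq_zero (hτ : 0 < τ.im) {v : ℂ} (h : theta4 τ v = 0) :
    theta1 τ v ≠ 0 := by
  intro h'
  obtain ⟨z, hz⟩ := exists_theta4_ne_zero hτ
  have e : ∀ a, theta4 τ (a + v) * theta4 τ (v - a) = 0 := fun a => by
    have e := theta_add₁ hτ a v (-a)
    rw [h, h', add_neg_cancel, ← sub_eq_add_neg] at e
    refine (mul_eq_zero.1 (?_ : theta4 τ 0 ^ 2 * _ = 0)).resolve_left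
      (pow_ne_zero 2 (theta4_zero_ne_zero hτ))
    linear_combination -e
  rcases eq_zero_or_eq_zero_of_mul_eq_zero
    ((differentiable_theta4 hτ).comp (differentiable_id.add_const v))
    ((differentiable_theta4 hτ).comp (differentiable_id.const_sub v)) e with h0 | h0
  · exact hz (by simpa using h0 (z - v))
  · exact hz (by simpa using h0 (v - z))

end

/-! ### The function `√k sn` in homogeneous coordinates -/

section

variable {τ r : ℂ}

theorem modulus_ne_zero (hτ : 0 < τ.im) : modulus τ ≠ 0 :=
  div_ne_zero (pow_ne_zero 2 (theta2_zero_ne_zero hτ)) (pow_ne_zero 2 (theta3_zero_ne_zero hτ))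

/-- Entire homogeneous coordinates of the point `√k sn z` of `ℂ ∪ {∞}`. The constant factor in the
first one is a sign, by `snVec_factor_sq`. -/
noncomputable def snVec (τ r z : ℂ) : ℂ × ℂ :=
  (r * (theta3 τ 0 / theta2 τ 0) * theta1 τ (thetaArg τ z), theta4 τ (thetaArg τ z))

theorem theta4_neg (v : ℂ) : theta4 τ (-v) = theta4 τ v := by
  simp only [theta4]
  rw [← jacobiTheta₂_neg_left, ← jacobiTheta₂_add_left]
  ring_nf

theorem snVec_neg_fst (hτ : 0 < τ.im) (z : ℂ) : (snVec τ r (-z)).1 = -(snVec τ r z).1 := by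
  simp only [snVec, thetaArg, neg_div, theta1_neg hτ, mul_neg]

theorem snVec_neg_snd (z : ℂ) : (snVec τ r (-z)).2 = (snVec τ r z).2 := by
  simp only [snVec, thetaArg, neg_div, theta4_neg]

theorem snVec_factor_sq (hτ : 0 < τ.im) (hr : r ^ 2 = modulus τ) :
    (r * (theta3 τ 0 / theta2 τ 0)) ^ 2 = 1 := by
  have h2 := theta2_zero_ne_zero hτ
  have h3 := theta3_zero_ne_zero hτ
  rw [mul_pow, hr, modulus]
  field_simp

theorem snVec_add₁ (hτ : 0 < τ.im) (hr : r ^ 2 = modulus τ) (a b c : ℂ) :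
    (snVec τ r a).2 * (snVec τ r b).2 * ((snVec τ r c).2 * (snVec τ r (a + b + c)).2) +
      (snVec τ r a).1 * (snVec τ r b).1 * ((snVec τ r c).1 * (snVec τ r (a + b + c)).1) =
    theta4 τ 0 * (snVec τ r (a + b)).2 * ((snVec τ r (b + c)).2 * (snVec τ r (a + c)).2) := by
  have h := theta_add₁ hτ (thetaArg τ a) (thetaArg τ b) (thetaArg τ c)
  have e := snVec_factor_sq hτ hr
  simp only [thetaArg, ← add_div] at h
  simp only [snVec, thetaArg]
  generalize r * (theta3 τ 0 / theta2 τ 0) = m at *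
  linear_combination h + theta1 τ (a / (Real.pi * theta3 τ 0 ^ 2)) *
    theta1 τ (b / (Real.pi * theta3 τ 0 ^ 2)) * theta1 τ (c / (Real.pi * theta3 τ 0 ^ 2)) *
    theta1 τ ((a + b + c) / (Real.pi * theta3 τ 0 ^ 2)) * (m ^ 2 + 1) * e

theorem snVec_add₂ (hτ : 0 < τ.im) (a b c : ℂ) :
    (snVec τ r a).1 * (snVec τ r b).2 * ((snVec τ r c).1 * (snVec τ r (a + b + c)).2) +
      (snVec τ r a).2 * (snVec τ r b).1 * ((snVec τ r c).2 * (snVec τ r (a + b + c)).1) =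
    theta4 τ 0 * (snVec τ r (a + c)).2 * ((snVec τ r (a + b)).1 * (snVec τ r (b + c)).1) := by
  have h := theta_add₂ hτ (thetaArg τ a) (thetaArg τ b) (thetaArg τ c)
  simp only [thetaArg, ← add_div] at h
  simp only [snVec, thetaArg]
  linear_combination (r * (theta3 τ 0 / theta2 τ 0)) ^ 2 * h

theorem snVec_snd_ne_zero {z : ℂ} (hz : ¬IsSnPole τ z) : (snVec τ r z).2 ≠ 0 := hz

theorem snVec_fst_eq {z : ℂ} (hz : ¬IsSnPole τ z) :
    (snVec τ r z).1 = r * sn τ z * (snVec τ r z).2 := by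
  have h : theta4 τ (thetaArg τ z) ≠ 0 := hz
  simp only [snVec, sn]
  field_simp

theorem exists_coords_scaledSn (hτ : 0 < τ.im) (hr : r ^ 2 = modulus τ) (z : ℂ) :
    ∃ k : ℂ, k ≠ 0 ∧ coords (scaledSn τ r z) = k • snVec τ r z := by
  by_cases hz : IsSnPole τ z
  · have h1 : (snVec τ r z).1 ≠ 0 := mul_ne_zero
      (fun h => by simpa [h] using snVec_factor_sq hτ hr) (theta1_ne_zero_of_theta4_eq_zero hτ hz)
    refine ⟨(snVec τ r z).1⁻¹, inv_ne_zero h1, ?_⟩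
    rw [scaledSn, if_pos hz]
    have h2 : (snVec τ r z).2 = 0 := hz
    exact Prod.ext (inv_mul_cancel₀ h1).symm (by simp [coords, h2])
  · have h2 := snVec_snd_ne_zero (r := r) hz
    refine ⟨(snVec τ r z).2⁻¹, inv_ne_zero h2, ?_⟩
    rw [scaledSn, if_neg hz]
    refine Prod.ext ?_ (inv_mul_cancel₀ h2).symm
    rw [Prod.smul_fst, snVec_fst_eq hz, smul_eq_mul]
    simp only [coords]
    field_simp

/-- The relation between the values of `√k sn` at the differences of `0`, `κ`, `α`, `β` that comes
from the pairs of opposite edges of the tetrahedron on these four points. -/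
theorem sn_relation₁ (hτ : 0 < τ.im) (hr : r ^ 2 = modulus τ) {α β κ : ℂ}
    (hα : ¬IsSnPole τ α) (hβ : ¬IsSnPole τ β) (hκ : ¬IsSnPole τ κ)
    (hαβ : ¬IsSnPole τ (α - β)) (hακ : ¬IsSnPole τ (α - κ)) (hβκ : ¬IsSnPole τ (β - κ)) :
    (r * sn τ α) * (r * sn τ (β - κ)) - (r * sn τ β) * (r * sn τ (α - κ)) +
      (r * sn τ κ) * (r * sn τ (α - β)) - (r * sn τ κ) * (r * sn τ (α - β)) * (r * sn τ α) *
        (r * sn τ β) * (r * sn τ (α - κ)) * (r * sn τ (β - κ)) = 0 := by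
  have h₁ := snVec_add₁ hτ hr κ (α - κ) (-(α - β))
  have h₂ := snVec_add₂ (r := r) hτ κ (α - κ) (-(α - β))
  rw [show κ + (α - κ) + -(α - β) = β by ring, show κ + (α - κ) = α by ring,
    show α - κ + -(α - β) = β - κ by ring, snVec_neg_fst hτ, snVec_neg_snd] at h₁ h₂
  rw [snVec_fst_eq hα, snVec_fst_eq hβκ, snVec_fst_eq hκ, snVec_fst_eq hακ, snVec_fst_eq hβ,
    snVec_fst_eq hαβ] at h₂
  rw [snVec_fst_eq hκ, snVec_fst_eq hακ, snVec_fst_eq hβ, snVec_fst_eq hαβ] at h₁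
  have hne : (snVec τ r κ).2 * (snVec τ r (α - κ)).2 * (snVec τ r (α - β)).2 *
      (snVec τ r β).2 ≠ 0 := mul_ne_zero (mul_ne_zero (mul_ne_zero hκ hακ) hαβ) hβ
  apply (mul_eq_zero.1 _).resolve_left hne
  linear_combination (r * sn τ α) * (r * sn τ (β - κ)) * h₁ - h₂

/-- The relation between the values of `√k sn` at the differences of `0`, `κ`, `α`, `β` that comes
from the four faces of the tetrahedron on these points. -/
theorem sn_relation₂ (hτ : 0 < τ.im) {α β κ : ℂ}
    (hα : ¬IsSnPole τ α) (hβ : ¬IsSnPole τ β) (hκ : ¬IsSnPole τ κ)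
    (hαβ : ¬IsSnPole τ (α - β)) (hακ : ¬IsSnPole τ (α - κ)) (hβκ : ¬IsSnPole τ (β - κ)) :
    (r * sn τ α) * (r * sn τ β) * (r * sn τ (α - β)) -
      (r * sn τ α) * (r * sn τ κ) * (r * sn τ (α - κ)) +
      (r * sn τ β) * (r * sn τ κ) * (r * sn τ (β - κ)) -
      (r * sn τ (α - β)) * (r * sn τ (α - κ)) * (r * sn τ (β - κ)) = 0 := by
  have h₁ := snVec_add₂ (r := r) hτ κ (-(α - β)) (α - κ)
  have h₂ := snVec_add₂ (r := r) hτ (-(α - β)) κ (α - κ)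
  rw [show κ + -(α - β) + (α - κ) = β by ring, show κ + (α - κ) = α by ring,
    show -(α - β) + (α - κ) = β - κ by ring, snVec_neg_fst hτ, snVec_neg_snd] at h₁
  rw [show -(α - β) + κ + (α - κ) = β by ring, show κ + (α - κ) = α by ring,
    show -(α - β) + (α - κ) = β - κ by ring, snVec_neg_fst hτ, snVec_neg_snd,
    add_comm (-(α - β)) κ] at h₂
  -- Only the numerator of the value at `κ + β - α` occurs, so this point may be a pole.
  generalize (snVec τ r (κ + -(α - β))).1 = t at h₁ h₂
  rw [snVec_fst_eq hβκ, snVec_fst_eq hκ, snVec_fst_eq hακ, snVec_fst_eq hβ,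
    snVec_fst_eq hαβ] at h₁
  rw [snVec_fst_eq hα, snVec_fst_eq hκ, snVec_fst_eq hακ, snVec_fst_eq hβ,
    snVec_fst_eq hαβ] at h₂
  have hne : (snVec τ r κ).2 * (snVec τ r (α - κ)).2 * (snVec τ r (α - β)).2 *
      (snVec τ r β).2 ≠ 0 := mul_ne_zero (mul_ne_zero (mul_ne_zero hκ hακ) hαβ) hβ
  apply (mul_eq_zero.1 _).resolve_left hne
  linear_combination (-(r * sn τ α)) * h₁ + (r * sn τ (β - κ)) * h₂

/-- On a pair `√k sn ζ`, `√k sn (ζ + α)` the form splits into two linear factors in the remaining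
variables. -/
theorem quadForm_snVec (hτ : 0 < τ.im) (hr : r ^ 2 = modulus τ) {α κ : ℂ}
    (hα : ¬IsSnPole τ α) (hκ : ¬IsSnPole τ κ) (hακ : ¬IsSnPole τ (α - κ)) (ζ : ℂ)
    (U A : ℂ × ℂ) :
    (snVec τ r κ).2 * (snVec τ r (α - κ)).2 *
      quadForm (r * sn τ α) (r * sn τ κ) (r * sn τ (α - κ)) U A (snVec τ r ζ) (snVec τ r (ζ + α)) =
    theta4 τ 0 * (snVec τ r α).1 * hsub U (snVec τ r (ζ + κ)) *
      hsub A (snVec τ r (ζ + α - κ)) := by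
  have h₁ := snVec_add₁ hτ hr κ (α - κ) ζ
  have h₂ := snVec_add₂ (r := r) hτ κ (α - κ) ζ
  have h₃ := snVec_add₂ (r := r) hτ (α - κ) κ ζ
  have h₄ := snVec_add₂ (r := r) hτ κ ζ (α - κ)
  rw [show κ + (α - κ) + ζ = ζ + α by ring, show κ + (α - κ) = α by ring,
    show α - κ + ζ = ζ + α - κ by ring, show κ + ζ = ζ + κ by ring] at h₁ h₂
  rw [show α - κ + κ + ζ = ζ + α by ring, show α - κ + κ = α by ring,
    show α - κ + ζ = ζ + α - κ by ring, show κ + ζ = ζ + κ by ring] at h₃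
  rw [show κ + ζ + (α - κ) = ζ + α by ring, show κ + (α - κ) = α by ring,
    show ζ + (α - κ) = ζ + α - κ by ring, show κ + ζ = ζ + κ by ring] at h₄
  rw [snVec_fst_eq hκ, snVec_fst_eq hακ] at h₁ h₂ h₃ h₄
  rw [snVec_fst_eq hα] at h₂ h₃ ⊢
  simp only [quadForm, hsub]
  linear_combination (r * sn τ α) * U.1 * A.1 * h₁ - U.1 * A.2 * h₂ - U.2 * A.1 * h₃ +
    (r * sn τ α) * U.2 * A.2 * h₄

theorem quadForm_smul₃₄ (p q d k l : ℂ) (U A B C : ℂ × ℂ) :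
    quadForm p q d U A (k • B) (l • C) = k * l * quadForm p q d U A B C := by
  simp only [quadForm, Prod.smul_fst, Prod.smul_snd, smul_eq_mul]; ring

/-- A bilinear form that splits into linear factors has vanishing determinant. -/
theorem disc12_quadForm_snVec (hτ : 0 < τ.im) (hr : r ^ 2 = modulus τ) {α κ : ℂ}
    (hα : ¬IsSnPole τ α) (hκ : ¬IsSnPole τ κ) (hακ : ¬IsSnPole τ (α - κ)) (ζ : ℂ) :
    (quadForm (r * sn τ α) (r * sn τ κ) (r * sn τ (α - κ))).disc12 (snVec τ r ζ)
      (snVec τ r (ζ + α)) = 0 := by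
  have hne : (snVec τ r κ).2 * (snVec τ r (α - κ)).2 ≠ 0 := mul_ne_zero hκ hακ
  have h := quadForm_snVec hτ hr hα hκ hακ ζ
  apply (mul_eq_zero.1 _).resolve_left (pow_ne_zero 2 hne)
  rw [Form.disc12]
  generalize quadForm (r * sn τ α) (r * sn τ κ) (r * sn τ (α - κ)) = F at *
  have e₁ := h (1, 0) (0, 1)
  have e₂ := h (0, 1) (1, 0)
  have e₃ := h (1, 0) (1, 0)
  have e₄ := h (0, 1) (0, 1)
  simp only [hsub] at e₁ e₂ e₃ e₄
  generalize (snVec τ r κ).2 * (snVec τ r (α - κ)).2 = m at *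
  rw [mul_sub, sq, mul_mul_mul_comm, mul_mul_mul_comm m m, e₁, e₂, e₃, e₄]
  ring

theorem disc12_quadForm_scaledSn (hτ : 0 < τ.im) (hr : r ^ 2 = modulus τ) {α κ : ℂ}
    (hα : ¬IsSnPole τ α) (hκ : ¬IsSnPole τ κ) (hακ : ¬IsSnPole τ (α - κ)) (ζ : ℂ) :
    (quadForm (r * sn τ α) (r * sn τ κ) (r * sn τ (α - κ))).disc12 (coords (scaledSn τ r ζ))
      (coords (scaledSn τ r (ζ + α))) = 0 := by
  obtain ⟨k, -, hk⟩ := exists_coords_scaledSn hτ hr ζ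
  obtain ⟨l, -, hl⟩ := exists_coords_scaledSn hτ hr (ζ + α)
  have h := disc12_quadForm_snVec hτ hr hα hκ hακ ζ
  rw [Form.disc12] at h
  rw [hk, hl, Form.disc12]
  simp only [quadForm_smul₃₄]
  linear_combination (k * l) ^ 2 * h

theorem exists_snVec_ne_zero (hτ : 0 < τ.im) (hr : r ^ 2 = modulus τ) (α : ℂ) :
    ∃ ζ, (snVec τ r ζ).1 * (snVec τ r ζ).2 *
      ((snVec τ r (ζ + α)).1 * (snVec τ r (ζ + α)).2) ≠ 0 := by
  have hm : r * (theta3 τ 0 / theta2 τ 0) ≠ 0 := fun h => by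
    simpa [h] using snVec_factor_sq hτ hr
  have hc : (Real.pi * theta3 τ 0 ^ 2 : ℂ) ≠ 0 :=
    mul_ne_zero (by simp [Real.pi_ne_zero]) (pow_ne_zero 2 (theta3_zero_ne_zero hτ))
  by_contra! h
  have h1 := differentiable_theta1 hτ
  have h4 := differentiable_theta4 hτ
  have h14 := h1.mul h4
  have h' : ∀ v, (theta1 τ v * theta4 τ v) *
      (theta1 τ (v + thetaArg τ α) * theta4 τ (v + thetaArg τ α)) = 0 := fun v => by
    have e := h (v * (Real.pi * theta3 τ 0 ^ 2))
    simp only [snVec, thetaArg, add_div, mul_div_cancel_right₀ _ hc] at e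
    apply (mul_eq_zero.1 _).resolve_left (pow_ne_zero 2 hm)
    simp only [thetaArg]
    linear_combination e
  have h0 : ∀ v, theta1 τ v * theta4 τ v = 0 := by
    rcases eq_zero_or_eq_zero_of_mul_eq_zero h14
      (h14.comp (differentiable_id.add_const (thetaArg τ α))) h' with h0 | h0
    · exact h0
    · intro v
      simpa using h0 (v - thetaArg τ α)
  obtain ⟨z, hz⟩ := exists_theta1_ne_zero hτ
  obtain ⟨z', hz'⟩ := exists_theta4_ne_zero hτ
  rcases eq_zero_or_eq_zero_of_mul_eq_zero h1 h4 h0 with h0 | h0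
  · exact hz (h0 z)
  · exact hz' (h0 z')

/-- If `√k sn` vanishes at `κ` or `α - κ`, then the Bäcklund equation is singular everywhere. -/
theorem disc34_quadForm_eq_zero (hτ : 0 < τ.im) (hr : r ^ 2 = modulus τ) {α κ : ℂ}
    (hα : ¬IsSnPole τ α) (hκ : ¬IsSnPole τ κ) (hακ : ¬IsSnPole τ (α - κ))
    (h : (r * sn τ κ) * (r * sn τ (α - κ)) = 0) (X Y : ℂ × ℂ) :
    (quadForm (r * sn τ α) (r * sn τ κ) (r * sn τ (α - κ))).disc34 X Y = 0 := by
  obtain ⟨ζ, hζ⟩ := exists_snVec_ne_zero hτ hr α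
  have e := disc12_quadForm_snVec hτ hr hα hκ hακ ζ
  generalize r * sn τ α = p at *
  generalize r * sn τ κ = s at *
  generalize r * sn τ (α - κ) = p' at *
  simp only [quadForm, Form.disc12, mul_zero, zero_mul, mul_one, add_zero, zero_add, sub_zero,
    zero_sub] at e
  have hT : s ^ 2 + p' ^ 2 - p ^ 2 = 0 := by
    apply (mul_eq_zero.1 _).resolve_left hζ
    generalize snVec τ r ζ = V at *
    generalize snVec τ r (ζ + α) = V' at *
    linear_combination e - (V.1 ^ 2 * V'.2 ^ 2 + V.2 ^ 2 * V'.1 ^ 2 - p ^ 2 * V.2 ^ 2 * V'.2 ^ 2 -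
      p ^ 2 * V.1 ^ 2 * V'.1 ^ 2 - p ^ 2 * s * p' * V.1 * V.2 * V'.1 * V'.2) * h
  simp only [quadForm, Form.disc34, mul_zero, mul_one, add_zero, zero_add, sub_zero, zero_sub]
  linear_combination X.1 * X.2 * Y.1 * Y.2 * hT + (X.1 ^ 2 * Y.2 ^ 2 + X.2 ^ 2 * Y.1 ^ 2 -
    p ^ 2 * X.2 ^ 2 * Y.2 ^ 2 - p ^ 2 * X.1 ^ 2 * Y.1 ^ 2 -
    p ^ 2 * s * p' * X.1 * X.2 * Y.1 * Y.2) * h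

/-- The factorisation of `quadForm_snVec` at finite `√k sn (ζ + κ)` and `√k sn (ζ + α - κ)`, with its
constant determined from the leading coefficient. -/
theorem quadForm_scaledSn (hτ : 0 < τ.im) (hr : r ^ 2 = modulus τ) {α κ ζ : ℂ}
    (hα : ¬IsSnPole τ α) (hκ : ¬IsSnPole τ κ) (hακ : ¬IsSnPole τ (α - κ))
    (hp : ¬IsSnPole τ (ζ + κ)) (hm : ¬IsSnPole τ (ζ + α - κ)) (U A : ℂ × ℂ) :
    quadForm (r * sn τ α) (r * sn τ κ) (r * sn τ (α - κ)) U A (coords (scaledSn τ r ζ))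
      (coords (scaledSn τ r (ζ + α))) =
    (r * sn τ α) * honeAdd (coords (scaledSn τ r ζ)) (coords (scaledSn τ r (ζ + α)))
      ((r * sn τ κ) * (r * sn τ (α - κ))) * hsubC U (r * sn τ (ζ + κ)) *
      hsubC A (r * sn τ (ζ + α - κ)) := by
  obtain ⟨k, -, hk⟩ := exists_coords_scaledSn hτ hr ζ
  obtain ⟨l, -, hl⟩ := exists_coords_scaledSn hτ hr (ζ + α)
  have hne : (snVec τ r κ).2 * (snVec τ r (α - κ)).2 ≠ 0 := mul_ne_zero hκ hακ
  have h := quadForm_snVec hτ hr hα hκ hακ ζ U A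
  have h₁ := snVec_add₁ hτ hr κ (α - κ) ζ
  rw [show κ + (α - κ) + ζ = ζ + α by ring, show κ + (α - κ) = α by ring,
    show α - κ + ζ = ζ + α - κ by ring, show κ + ζ = ζ + κ by ring, snVec_fst_eq hκ,
    snVec_fst_eq hακ] at h₁
  rw [hk, hl, quadForm_smul₃₄]
  apply mul_left_cancel₀ hne
  generalize quadForm (r * sn τ α) (r * sn τ κ) (r * sn τ (α - κ)) U A _ _ = F at *
  simp only [hsub, snVec_fst_eq hα, snVec_fst_eq hp, snVec_fst_eq hm] at h
  simp only [honeAdd, hsubC, Prod.smul_fst, Prod.smul_snd, smul_eq_mul]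
  linear_combination k * l * h - (r * sn τ α) * (U.1 - r * sn τ (ζ + κ) * U.2) *
    (A.1 - r * sn τ (ζ + α - κ) * A.2) * k * l * h₁

end

/-! ### Möbius transformations and cross-ratios -/

theorem coords_ne_zero (x : OnePoint ℂ) : coords x ≠ 0 := by
  induction x using OnePoint.rec <;> simp [coords]

theorem hsub_coords_eq_zero {x y : OnePoint ℂ} (h : hsub (coords x) (coords y) = 0) : x = y := by
  induction x using OnePoint.rec <;> induction y using OnePoint.rec <;>
    simp [coords, hsub] at h ⊢
  linear_combination h

theorem ratio_eq_ratio {N D N' D' : ℂ} (h : N ≠ 0 ∨ D ≠ 0) (h' : N' ≠ 0 ∨ D' ≠ 0)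
    (e : N * D' = N' * D) : ratio N D = ratio N' D' := by
  unfold ratio
  by_cases hD : D = 0
  · have : D' = 0 := by
      have hN : N ≠ 0 := h.resolve_right (by simp [hD])
      simpa [hD, hN] using e
    simp [hD, this]
  · have : D' ≠ 0 := by
      intro h0
      rw [h0, mul_zero, eq_comm, mul_eq_zero] at e
      simp [h0, hD] at h' e
      exact h' e
    rw [if_neg hD, if_neg this]
    congr 1
    field_simp
    linear_combination e

theorem cross_ne_zero {a b c d : OnePoint ℂ} (h : NoThreeCoincide a b c d) :
    hsub (coords a) (coords b) * hsub (coords c) (coords d) ≠ 0 ∨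
      hsub (coords a) (coords c) * hsub (coords b) (coords d) ≠ 0 := by
  by_contra! hc
  obtain ⟨h₁, h₂, h₃, h₄⟩ := h
  rcases mul_eq_zero.1 hc.1 with h | h <;> rcases mul_eq_zero.1 hc.2 with h' | h' <;>
    (have e := hsub_coords_eq_zero h; have e' := hsub_coords_eq_zero h'; subst e; subst e'
     simp_all)

theorem exists_coords_smul (g : GL (Fin 2) ℂ) (x : OnePoint ℂ) :
    ∃ t : ℂ, t ≠ 0 ∧ t • coords (g • x) =
      (g 0 0 * (coords x).1 + g 0 1 * (coords x).2, g 1 0 * (coords x).1 + g 1 1 * (coords x).2) := by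
  have hdet : g 0 0 * g 1 1 - g 0 1 * g 1 0 ≠ 0 := by
    rw [← Matrix.det_fin_two]
    exact g.det_ne_zero
  induction x using OnePoint.rec with
  | infty =>
    rw [OnePoint.smul_infty_eq_ite]
    split_ifs with h
    · refine ⟨g 0 0, fun h0 => hdet (by rw [h0, h]; ring), ?_⟩
      simp [coords, h]
    · refine ⟨g 1 0, h, ?_⟩
      simp [coords]
      field_simp
  | coe x =>
    rw [OnePoint.smul_some_eq_ite]
    split_ifs with h
    · refine ⟨g 0 0 * x + g 0 1, fun h0 => ?_, ?_⟩
      · exact hdet (by linear_combination g 0 0 * h - g 1 0 * h0)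
      · simp [coords, h]
    · refine ⟨_, h, ?_⟩
      simp [coords]
      field_simp

theorem exists_hsub_smul (g : GL (Fin 2) ℂ) : ∃ δ : ℂ, δ ≠ 0 ∧ ∃ t : OnePoint ℂ → ℂ,
    (∀ x, t x ≠ 0) ∧ ∀ x y, t x * t y * hsub (coords (g • x)) (coords (g • y)) =
      δ * hsub (coords x) (coords y) := by
  have hdet : g 0 0 * g 1 1 - g 0 1 * g 1 0 ≠ 0 := by
    rw [← Matrix.det_fin_two]
    exact g.det_ne_zero
  choose t ht ht' using exists_coords_smul g
  refine ⟨_, hdet, t, ht, fun x y => ?_⟩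
  have e₁ := ht' x
  have e₂ := ht' y
  simp only [Prod.ext_iff, Prod.smul_fst, Prod.smul_snd, smul_eq_mul] at e₁ e₂
  simp only [hsub]
  linear_combination e₁.1 * (t y * (coords (g • y)).2) +
    (g 0 0 * (coords x).1 + g 0 1 * (coords x).2) * e₂.2 - e₂.1 * (t x * (coords (g • x)).2) -
    (g 0 0 * (coords y).1 + g 0 1 * (coords y).2) * e₁.2

theorem ratio_mul_left {c : ℂ} (hc : c ≠ 0) (N D : ℂ) : ratio (c * N) (c * D) = ratio N D := by
  unfold ratio
  simp only [mul_eq_zero, hc, false_or, mul_div_mul_left _ _ hc]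

theorem crossRatio_smul (g : GL (Fin 2) ℂ) (a b c d : OnePoint ℂ) :
    crossRatio (g • a) (g • b) (g • c) (g • d) = crossRatio a b c d := by
  obtain ⟨δ, hδ, t, ht, h⟩ := exists_hsub_smul g
  have ht' := mul_ne_zero (mul_ne_zero (ht a) (ht b)) (mul_ne_zero (ht c) (ht d))
  refine ((ratio_mul_left ht' _ _).symm.trans (congrArg₂ ratio ?_ ?_)).trans
    (ratio_mul_left (pow_ne_zero 2 hδ) _ _)
  · linear_combination t c * t d * hsub (coords (g • c)) (coords (g • d)) * h a b +
      δ * hsub (coords a) (coords b) * h c d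
  · linear_combination t b * t d * hsub (coords (g • b)) (coords (g • d)) * h a c +
      δ * hsub (coords a) (coords c) * h b d

theorem NoThreeCoincide.map {a b c d : OnePoint ℂ} (h : NoThreeCoincide a b c d)
    (f : Equiv.Perm (OnePoint ℂ)) : NoThreeCoincide (f a) (f b) (f c) (f d) := by
  simpa only [NoThreeCoincide, f.injective.eq_iff] using h

theorem crossRatio_moebius (f : Moebius) (a b c d : OnePoint ℂ) :
    crossRatio (f.1 a) (f.1 b) (f.1 c) (f.1 d) = crossRatio a b c d := by
  obtain ⟨f, g, rfl⟩ := f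
  exact crossRatio_smul g a b c d

/-! ### The identity -/

/-- In homogeneous coordinates the Riccati map is the linear map `Form.lin`. -/
theorem exists_lin_coords_eq {p q d : ℂ} {U A : ℂ × ℂ} {f : OnePoint ℂ → OnePoint ℂ}
    (hf : ∀ v, quadForm p q d U A (coords v) (coords (f v)) = 0) (v : OnePoint ℂ) :
    ∃ k : ℂ, (quadForm p q d).lin U A (coords v) = k • coords (f v) := by
  have h := hf v
  rw [quadForm_eq_hsub] at h
  refine exists_smul_of_hsub_eq_zero (coords_ne_zero (f v)) ?_
  simp only [hsub] at h ⊢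
  linear_combination -h

theorem quadForm_of_qForm {τ r : ℂ} (hr : r ^ 2 = modulus τ) (α β : ℂ) (U A B C : ℂ × ℂ) :
    quadForm (r * sn τ α) (r * sn τ β) (r * sn τ (α - β)) U A B C =
      r * qForm τ α β U A B C := by
  simp only [quadForm, qForm, ← hr]
  ring

/-- The numerator and the denominator of the cross-ratio of `W`, `X₁`, `X₂`, `X₃`, where `W₁`, `W₂`,
`W₃` are the images of `X₁`, `X₂`, `X₃` at the other three vertices of the square, up to a common
factor `l`. By `lin_lin_comm` the remaining factors `m` and `n` have a known ratio. -/
theorem cross_mul_eq {p q d s p' q' : ℂ} (hs : s ≠ 0) (hp' : p' ≠ 0)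
    (h₁ : p * q' - q * p' + s * d - s * d * p * q * p' * q' = 0)
    (h₂ : p * q * d - p * s * p' + q * s * q' - d * p' * q' = 0)
    {U A B C : ℂ × ℂ} (hU : U ≠ 0) (hA : A ≠ 0) (hB : B ≠ 0) (hC : C ≠ 0)
    (hF : quadForm p q d U A B C = 0)
    (hUA : (quadForm p s p').disc34 U A ≠ 0) (hUB : (quadForm q s q').disc34 U B ≠ 0)
    (hBC : (quadForm p s p').disc34 B C ≠ 0) (hAC : (quadForm q s q').disc34 A C ≠ 0)
    {W W₁ W₂ W₃ X₁ X₂ X₃ : ℂ × ℂ} (hW₃ : W₃ ≠ 0) {b c e e' : ℂ}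
    (hX₁ : (quadForm p s p').lin U A X₁ = b • W₁)
    (hX₂ : (quadForm q s q').lin U B X₂ = c • W₂)
    (hX₃ : (quadForm q s q').lin A C ((quadForm p s p').lin U A X₃) = e • W₃)
    (hX₃' : (quadForm p s p').lin B C ((quadForm q s q').lin U B X₃) = e' • W₃) :
    ∃ m n : ℂ, p * p' * n = q * q' * m ∧ ∃ l : ℂ, l ≠ 0 ∧
      l * (hsub W X₁ * hsub X₂ X₃) =
        n * (quadForm p s p' U A W W₁ * quadForm p s p' B C W₂ W₃) ∧
      l * (hsub W X₂ * hsub X₁ X₃) =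
        m * (quadForm q s q' U B W W₂ * quadForm q s q' A C W₁ W₃) := by
  have comm := lin_lin_comm hs hp' h₁ h₂ hU hA hB hC hF hUA hAC X₃
  rw [hX₃, hX₃', smul_smul, smul_smul] at comm
  have hsc := smul_left_injective ℂ hW₃ comm
  have f₁ := hsub_lin_lin p s p' U A W X₁
  have f₂ := hsub_lin_lin q s q' U B W X₂
  have f₃ := hsub_lin_lin p s p' B C ((quadForm q s q').lin U B X₂)
    ((quadForm q s q').lin U B X₃)
  have f₄ := hsub_lin_lin q s q' A C ((quadForm p s p').lin U A X₁)
    ((quadForm p s p').lin U A X₃)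
  rw [hsub_lin_lin q s q' U B X₂ X₃, hX₂, hX₃', lin_smul] at f₃
  rw [hsub_lin_lin p s p' U A X₁ X₃, hX₁, hX₃, lin_smul] at f₄
  rw [hX₁] at f₁
  rw [hX₂] at f₂
  refine ⟨-(b * c * e * (quadForm p s p').disc34 B C), -(b * c * e' * (quadForm q s q').disc34 A C),
    by linear_combination -(b * c) * hsc,
    _, mul_ne_zero (mul_ne_zero hUA hUB) (mul_ne_zero hBC hAC), ?_, ?_⟩
  · rw [quadForm_eq_hsub p s p' U A, quadForm_eq_hsub p s p' B C]
    generalize (quadForm p s p').lin U A W = L at *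
    generalize (quadForm p s p').lin B C W₂ = L' at *
    generalize (quadForm p s p').disc34 U A = D₁ at *
    generalize (quadForm q s q').disc34 U B = D₂ at *
    generalize (quadForm p s p').disc34 B C = D₃ at *
    generalize (quadForm q s q').disc34 A C = D₄ at *
    have g₁ : D₁ * hsub W X₁ = b * hsub W₁ L := by
      simp only [hsub, Prod.smul_fst, Prod.smul_snd, smul_eq_mul] at f₁ ⊢
      linear_combination f₁
    have g₃ : D₂ * D₃ * hsub X₂ X₃ = -(c * e' * hsub W₃ L') := by
      simp only [hsub, Prod.smul_fst, Prod.smul_snd, smul_eq_mul] at f₃ ⊢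
      linear_combination -f₃
    linear_combination D₄ * D₂ * D₃ * hsub X₂ X₃ * g₁ + D₄ * b * hsub W₁ L * g₃
  · rw [quadForm_eq_hsub q s q' U B, quadForm_eq_hsub q s q' A C]
    generalize (quadForm q s q').lin U B W = L at *
    generalize (quadForm q s q').lin A C W₁ = L' at *
    generalize (quadForm p s p').disc34 U A = D₁ at *
    generalize (quadForm q s q').disc34 U B = D₂ at *
    generalize (quadForm p s p').disc34 B C = D₃ at *
    generalize (quadForm q s q').disc34 A C = D₄ at *
    have g₂ : D₂ * hsub W X₂ = c * hsub W₂ L := by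
      simp only [hsub, Prod.smul_fst, Prod.smul_snd, smul_eq_mul] at f₂ ⊢
      linear_combination f₂
    have g₄ : D₁ * D₄ * hsub X₁ X₃ = -(b * e * hsub W₃ L') := by
      simp only [hsub, Prod.smul_fst, Prod.smul_snd, smul_eq_mul] at f₄ ⊢
      linear_combination -f₄
    linear_combination D₃ * D₁ * D₄ * hsub X₁ X₃ * g₂ + D₃ * c * hsub W₂ L * g₄

end Q4

open Q4 in
theorem proposition1
    (τ : ℂ) (hτ : 0 < τ.im) (r : ℂ) (hr : r ^ 2 = modulus τ)
    (α β κ ζ₀ : ℂ)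
    (hα : ¬ IsSnPole τ α) (hβ : ¬ IsSnPole τ β) (hκ : ¬ IsSnPole τ κ)
    (hαβ : ¬ IsSnPole τ (α - β)) (hακ : ¬ IsSnPole τ (α - κ)) (hβκ : ¬ IsSnPole τ (β - κ))
    (w : ℤ → ℤ → OnePoint ℂ) (hw : ∀ n m, w n m = scaledSn τ r (zeta ζ₀ α β n m)) :
    IsDualSingular (qForm τ α κ) (qForm τ β κ) w ∧
    ∀ u φ : ℤ → ℤ → OnePoint ℂ,
      IsSolution (qForm τ α β) u →
      IsNonsingular (qForm τ α κ) (qForm τ β κ) u →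
      IsSchwarzianVariable (qForm τ α κ) (qForm τ β κ) w u φ →
      ∀ n m : ℤ, ∀ ζ : ℂ, ζ = zeta ζ₀ α β n m →
        NoThreeCoincide (φ n m) (φ (n + 1) m) (φ n (m + 1)) (φ (n + 1) (m + 1)) →
        ¬ IsSnPole τ (ζ + κ) → ¬ IsSnPole τ (ζ + α + κ) → ¬ IsSnPole τ (ζ + β + κ) →
        ¬ IsSnPole τ (ζ + α - κ) → ¬ IsSnPole τ (ζ + β - κ) → ¬ IsSnPole τ (ζ + α + β - κ) →
        (rhsNum τ r α β κ ζ (u (n + 1) m) (u n (m + 1)) ≠ 0 ∨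
          rhsDen τ r α β κ ζ (u (n + 1) m) (u n (m + 1)) ≠ 0) ∧
        crossRatio (φ n m) (φ (n + 1) m) (φ n (m + 1)) (φ (n + 1) (m + 1)) =
          ratio (rhsNum τ r α β κ ζ (u (n + 1) m) (u n (m + 1)))
            (rhsDen τ r α β κ ζ (u (n + 1) m) (u n (m + 1))) := by
  have hm := modulus_ne_zero hτ
  have hr0 : r ≠ 0 := fun h => hm (by rw [← hr, h]; ring)
  have hzα : ∀ n m, zeta ζ₀ α β (n + 1) m = zeta ζ₀ α β n m + α := fun n m => by
    simp only [zeta]; push_cast; ring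
  have hzβ : ∀ n m, zeta ζ₀ α β n (m + 1) = zeta ζ₀ α β n m + β := fun n m => by
    simp only [zeta]; push_cast; ring
  have hquad : ∀ a b : ℂ, quadForm (r * sn τ a) (r * sn τ b) (r * sn τ (a - b)) =
      fun U A B C => r * qForm τ a b U A B C := fun a b => by
    funext U A B C
    exact quadForm_of_qForm hr a b U A B C
  have hvan : ∀ {a b : ℂ} {U A B C : ℂ × ℂ}, qForm τ a b U A B C = 0 →
      quadForm (r * sn τ a) (r * sn τ b) (r * sn τ (a - b)) U A B C = 0 := fun h => by
    rw [quadForm_of_qForm hr, h, mul_zero]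
  have h34 : ∀ {a b : ℂ} {U A : ℂ × ℂ}, (qForm τ a b).disc34 U A ≠ 0 →
      (quadForm (r * sn τ a) (r * sn τ b) (r * sn τ (a - b))).disc34 U A ≠ 0 := fun {a b U A} h => by
    have : (quadForm (r * sn τ a) (r * sn τ b) (r * sn τ (a - b))).disc34 U A =
        r ^ 2 * (qForm τ a b).disc34 U A := by
      rw [hquad, Form.disc34, Form.disc34]; ring
    rw [this]
    exact mul_ne_zero (pow_ne_zero 2 hr0) h
  have h12 : ∀ {a ζ : ℂ}, ¬IsSnPole τ a → ¬IsSnPole τ (a - κ) →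
      (qForm τ a κ).disc12 (coords (scaledSn τ r ζ)) (coords (scaledSn τ r (ζ + a))) = 0 :=
    fun {a ζ} ha haκ => by
      have h := disc12_quadForm_scaledSn hτ hr ha hκ haκ ζ
      rw [hquad, Form.disc12] at h
      apply (mul_eq_zero.1 (?_ : r ^ 2 * _ = 0)).resolve_left (pow_ne_zero 2 hr0)
      rw [Form.disc12]
      linear_combination h
  refine ⟨fun n m => ?_, ?_⟩
  · rw [hw, hw, hw, hzα, hzβ]
    exact ⟨h12 hα hακ, h12 hβ hβκ⟩
  rintro u φ hu hns ⟨s, ⟨m₁, m₂, hs⟩, hφ⟩ n m ζ rfl h3 hp1 hp2 hp3 hp4 hp5 hp6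
  -- Applying `s n m` to the four values of `φ` changes neither the cross-ratio nor the coincidences;
  -- `w n m`, `x₁`, `x₂`, `x₃` are the four images.
  have hσ : ∀ n m, (s n m).1 (φ n m) = w n m := fun n m => by
    rw [hφ]; exact (s n m).1.apply_symm_apply _
  have e₁ := exists_lin_coords_eq (f := (m₁ n m).1) (fun v => hvan ((hs n m).1 v))
  have e₂ := exists_lin_coords_eq (f := (m₂ n m).1) (fun v => hvan ((hs n m).2.1 v))
  have e₃ := exists_lin_coords_eq (f := (m₁ n (m + 1)).1) (fun v => hvan ((hs n (m + 1)).1 v))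
  have e₄ := exists_lin_coords_eq (f := (m₂ (n + 1) m).1) (fun v => hvan ((hs (n + 1) m).2.1 v))
  have w₁ : (m₁ n m).1 ((s n m).1 (φ (n + 1) m)) = w (n + 1) m := by
    rw [← hσ, (hs n m).2.2.1]; rfl
  have w₂ : (m₂ n m).1 ((s n m).1 (φ n (m + 1))) = w n (m + 1) := by
    rw [← hσ, (hs n m).2.2.2]; rfl
  have w₃ : (m₁ n (m + 1)).1 ((m₂ n m).1 ((s n m).1 (φ (n + 1) (m + 1)))) =
      w (n + 1) (m + 1) := by
    rw [← hσ, (hs n (m + 1)).2.2.1, (hs n m).2.2.2]; rfl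
  have w₄ : (m₂ (n + 1) m).1 ((m₁ n m).1 ((s n m).1 (φ (n + 1) (m + 1)))) =
      w (n + 1) (m + 1) := by
    rw [← hσ, (hs (n + 1) m).2.2.2, (hs n m).2.2.1]; rfl
  have hcr := crossRatio_moebius (s n m) (φ n m) (φ (n + 1) m) (φ n (m + 1)) (φ (n + 1) (m + 1))
  replace h3 := cross_ne_zero (h3.map (s n m).1)
  rw [← hcr]
  rw [hσ] at h3 ⊢
  generalize (s n m).1 (φ (n + 1) m) = x₁ at *
  generalize (s n m).1 (φ n (m + 1)) = x₂ at *
  generalize (s n m).1 (φ (n + 1) (m + 1)) = x₃ at *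
  obtain ⟨b, hX₁⟩ := e₁ x₁
  obtain ⟨c, hX₂⟩ := e₂ x₂
  obtain ⟨k₁, hY₁⟩ := e₁ x₃
  obtain ⟨k₂, hY₂⟩ := e₂ x₃
  obtain ⟨k₃, hY₃⟩ := e₃ ((m₂ n m).1 x₃)
  obtain ⟨k₄, hY₄⟩ := e₄ ((m₁ n m).1 x₃)
  rw [w₁] at hX₁
  rw [w₂] at hX₂
  rw [w₃] at hY₃
  rw [w₄] at hY₄
  -- Non-singularity makes `p'` and `q'` nonzero.
  have hsp : (r * sn τ κ) * (r * sn τ (α - κ)) ≠ 0 := fun h =>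
    h34 (hns n m).1 (disc34_quadForm_eq_zero hτ hr hα hκ hακ h _ _)
  have hsq : (r * sn τ κ) * (r * sn τ (β - κ)) ≠ 0 := fun h =>
    h34 (hns n m).2 (disc34_quadForm_eq_zero hτ hr hβ hκ hβκ h _ _)
  obtain ⟨M, N, hMN, l, hl, E₁, E₂⟩ := cross_mul_eq (left_ne_zero_of_mul hsp)
    (right_ne_zero_of_mul hsp) (sn_relation₁ hτ hr hα hβ hκ hαβ hακ hβκ)
    (sn_relation₂ hτ hα hβ hκ hαβ hακ hβκ) (coords_ne_zero (u n m)) (coords_ne_zero _)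
    (coords_ne_zero _) (coords_ne_zero _) (hvan (hu n m)) (h34 (hns n m).1) (h34 (hns n m).2)
    (h34 (hns n (m + 1)).1) (h34 (hns (n + 1) m).2) (W := coords (w n m))
    (coords_ne_zero (w (n + 1) (m + 1))) hX₁ hX₂
    (by rw [hY₁, lin_smul, hY₄, smul_smul]) (by rw [hY₂, lin_smul, hY₃, smul_smul])
  rw [hw] at h3 ⊢
  have z₁ := hzα n m
  have z₂ := hzβ n m
  have z₃ := hzβ (n + 1) m
  rw [z₁] at z₃
  rw [hw, hw, hw, hw, z₁, z₂, z₃] at E₁ E₂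
  generalize zeta ζ₀ α β n m = ζ at *
  rw [quadForm_scaledSn hτ hr hα hκ hακ hp1 hp4, add_right_comm ζ α β,
    quadForm_scaledSn hτ hr hα hκ hακ hp3 (by rwa [add_right_comm] at hp6)] at E₁
  rw [quadForm_scaledSn hτ hr hβ hκ hβκ hp1 hp5,
    quadForm_scaledSn hτ hr hβ hκ hβκ hp2 hp6] at E₂
  have hp' := right_ne_zero_of_mul hsp
  have hq' := right_ne_zero_of_mul hsq
  rw [crossRatio, rhsNum, rhsDen, add_right_comm ζ α β]
  generalize hsub (coords (scaledSn τ r ζ)) (coords x₁) * hsub (coords x₂) (coords x₃) = X at *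
  generalize hsub (coords (scaledSn τ r ζ)) (coords x₂) * hsub (coords x₁) (coords x₃) = Y at *
  generalize r * sn τ α = p at *
  generalize r * sn τ β = q at *
  generalize r * sn τ κ = s' at *
  generalize r * sn τ (α - κ) = p' at *
  generalize r * sn τ (β - κ) = q' at *
  -- The linear factors at the first and the last vertex are common to both products.
  set G := hsubC (coords (u n m)) (r * sn τ (ζ + κ)) *
    hsubC (coords (u (n + 1) (m + 1))) (r * sn τ (ζ + α + β - κ)) with hG
  rw [add_right_comm ζ β α] at E₁ ⊢
  set R := p * q' * _ * _ * _ * _ with hR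
  set S := q * p' * _ * _ * _ * _ with hS
  have E₁' : q' * (l * X) = N * p * G * R := by rw [E₁, hG, hR]; ring
  have E₂' : p' * (l * Y) = M * q * G * S := by rw [E₂, hG, hS]; ring
  -- If both vanished, so would the numerator and the denominator of the cross-ratio.
  have hne : R ≠ 0 ∨ S ≠ 0 := by
    by_contra! h0
    rw [h0.1, mul_zero] at E₁'
    rw [h0.2, mul_zero] at E₂'
    simp only [mul_eq_zero, hp', hq', hl, false_or] at E₁' E₂'
    exact h3.elim (· E₁') (· E₂')
  refine ⟨hne, ratio_eq_ratio h3 hne ?_⟩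
  apply mul_left_cancel₀ (mul_ne_zero (mul_ne_zero hp' hq') hl)
  linear_combination p' * S * E₁' - q' * R * E₂' + G * R * S * hMN
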